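/- Let $d\ge 1$ and let $\mu$ be a (positive Borel) measure on $\mathbb R$ that is non-degenerate in degree $d$: the moments $m_k=\int t^k\,d\mu$ exist and are finite for $0\le k\le 2d$, and $\int f\,d\mu>0$ for every nonzero polynomial $f\in\mathbb R[t]$ of degree at most $2d$ that is nonnegative on $\mathbb R$. For $x\in\mathbb R$ and a polynomial $f=\sum_{k=0}^{2d}f_kt^k$ put $\mathrm{ev}_x(f)=f(x)$, and put $\mathrm{ev}_\infty(f)=f_{2d}$. A quadrature rule of degree $2d$ for $\mu$ is a finite set $N\subset\mathbb R\cup\{\infty\}$ (its nodes) with a function $w:N\to\mathbb R_{>0}$ such that $\int f\,d\mu=\sum_{r\in N}w(r)\,\mathrm{ev}_r(f)$ for all $f\in\mathbb R[t]$ of degree at most $2d$. It is Gaussian if no quadrature rule of degree $2d$ for $\mu$ has fewer nodes. Let $M_{d-1}=(m_{i+j-2})$, $M'_{d-1}=(m_{i+j-1})$, $M''_{d-1}=(m_{i+j})$ for $1\le i,j\le d$, and $M_d=(m_{i+j-2})$ for $1\le i,j\le d+1$. There is a polynomial $F\in\mathbb R[\mathbf x,\mathbf y]$ of total degree $2d$,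 unique up to multiplication by a nonzero real constant among polynomials of total degree $2d$, with the following property: for all $x,y\in\mathbb R$, one has $F(x,y)=0$ if and only if there is a Gaussian quadrature rule of degree $2d$ for $\mu$ with exactly $d+1$ (distinct) nodes $r_1=x,\ r_2=y,\ r_3,\dots,r_{d+1}\in\mathbb R\cup\{\infty\}$. Suitably scaled, this polynomial satisfies both of the following. (a) $F=\det\bigl(\mathbf x\mathbf y\,M_{d-1}-(\mathbf x+\mathbf y)M'_{d-1}+M''_{d-1}\bigr)$. (b) With $e_d=(0,\dots,0,1)^T\in\mathbb R^d$ and $c=(-1)^d\det(M_d)/\det(M_{d-1})^2$, $$(\mathbf x-\mathbf y)\,F=c\cdot\det\begin{pmatrix}\frac{\det M_{d-1}}{\det M_d}(\mathbf x-\mathbf y)&e_d^T&e_d^T\\ e_d&\mathbf x M_{d-1}-M'_{d-1}&0\\ e_d&0&-\mathbf y M_{d-1}+M'_{d-1}\end{pmatrix}.$$ Moreover, for every $x\in\mathbb R$ with $\det(xM_{d-1}-M'_{d-1})\ne 0$, there is a unique Gaussian quadrature rule of degree $2d$ for $\mu$ with $d+1$ nodes one of which is $x$, and all of its nodes are real,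 i.e. $\infty$ is not a node. -/

import Mathlib

open MeasureTheory MvPolynomial

noncomputable section

/-- The moments of `μ` up to degree `D` exist and are finite. -/
def HasFiniteMoments (μ : Measure ℝ) (D : ℕ) : Prop :=
  ∀ k ≤ D, Integrable (fun t : ℝ => t ^ k) μ

/-- `μ` is non-degenerate in degree `d`: its moments are finite up to degree `2d`, and every
nonzero polynomial of degree at most `2d` that is nonnegative on `ℝ` has positive integral. -/
def NonDegenerate (μ : Measure ℝ) (d : ℕ) : Prop :=
  HasFiniteMoments μ (2 * d) ∧
    ∀ f : Polynomial ℝ, f ≠ 0 → f.natDegree ≤ 2 * d → (∀ t : ℝ, 0 ≤ f.eval t) →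
      0 < ∫ t, f.eval t ∂μ

/-- Evaluation of polynomials of degree at most `D` at a point of `ℝ ∪ {∞}`; the value at `∞` is
the coefficient of degree `D`. -/
def evalAt (D : ℕ) (x : OnePoint ℝ) (f : Polynomial ℝ) : ℝ :=
  OnePoint.rec (f.coeff D) (fun r : ℝ => f.eval r) x

/-- A quadrature rule of degree `D` for `μ`: a finite set of nodes in `ℝ ∪ {∞}` with positive
weights that integrates all polynomials of degree at most `D` exactly. -/
structure QuadratureRule (μ : Measure ℝ) (D : ℕ) where
  nodes : Finset (OnePoint ℝ)
  weight : nodes → ℝ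
  weight_pos : ∀ x, 0 < weight x
  finite_moments : HasFiniteMoments μ D
  exact : ∀ f : Polynomial ℝ, f.natDegree ≤ D →
    ∫ t, f.eval t ∂μ = ∑ x : nodes, weight x * evalAt D x f

/-- A quadrature rule is Gaussian if it has the fewest possible nodes among all quadrature rules
of the same degree for the same measure. -/
def QuadratureRule.IsGaussian {μ : Measure ℝ} {D : ℕ} (R : QuadratureRule μ D) : Prop :=
  ∀ R' : QuadratureRule μ D, R.nodes.card ≤ R'.nodes.card

/-- `G` has total degree `2d`, and its real zeros are exactly the pairs `(x, y)` of real numbers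
that are two (distinct) nodes of some Gaussian quadrature rule of degree `2d` for `μ`
with `d + 1` nodes. -/
def IsNodePolynomial (μ : Measure ℝ) (d : ℕ) (G : MvPolynomial (Fin 2) ℝ) : Prop :=
  G.totalDegree = 2 * d ∧
    ∀ x y : ℝ, eval ![x, y] G = 0 ↔
      ∃ R : QuadratureRule μ (2 * d), R.IsGaussian ∧ R.nodes.card = d + 1 ∧
        x ≠ y ∧ (x : OnePoint ℝ) ∈ R.nodes ∧ (y : OnePoint ℝ) ∈ R.nodes

/-- The `n × n` Hankel matrix `(m_{i+j+k})`, `0 ≤ i, j < n`, of moments of `μ`. So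
`M_{n-1}`, `M'_{n-1}`, `M''_{n-1}` are `hankel μ 0 n`, `hankel μ 1 n`, `hankel μ 2 n`. -/
def hankel (μ : Measure ℝ) (k n : ℕ) : Matrix (Fin n) (Fin n) ℝ :=
  Matrix.of fun i j => ∫ t : ℝ, t ^ ((i : ℕ) + (j : ℕ) + k) ∂μ

/-- A real matrix viewed as a matrix of constant polynomials in the two variables. -/
def constMatrix {n : ℕ} (A : Matrix (Fin n) (Fin n) ℝ) :
    Matrix (Fin n) (Fin n) (MvPolynomial (Fin 2) ℝ) :=
  A.map C

/-- `xy M_{d-1} - (x + y) M'_{d-1} + M''_{d-1}`, where `x = X 0` and `y = X 1`. -/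
def bilinearMatrix (μ : Measure ℝ) (d : ℕ) :
    Matrix (Fin d) (Fin d) (MvPolynomial (Fin 2) ℝ) :=
  (X 0 * X 1 : MvPolynomial (Fin 2) ℝ) • constMatrix (hankel μ 0 d)
    - (X 0 + X 1 : MvPolynomial (Fin 2) ℝ) • constMatrix (hankel μ 1 d)
    + constMatrix (hankel μ 2 d)

/-- The last standard basis vector `e_d = (0, …, 0, 1)`. -/
def lastVec (d : ℕ) (i : Fin d) : MvPolynomial (Fin 2) ℝ :=
  if (i : ℕ) + 1 = d then 1 else 0

/-- The `(2d+1) × (2d+1)` block matrix with rows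
`((det M_{d-1} / det M_d)(x - y), e_dᵀ, e_dᵀ)`, `(e_d, x M_{d-1} - M'_{d-1}, 0)` and
`(e_d, 0, -y M_{d-1} + M'_{d-1})`, where `x = X 0` and `y = X 1`. -/
def linearMatrix (μ : Measure ℝ) (d : ℕ) :
    Matrix (Unit ⊕ (Fin d ⊕ Fin d)) (Unit ⊕ (Fin d ⊕ Fin d)) (MvPolynomial (Fin 2) ℝ) :=
  Matrix.fromBlocks
    (Matrix.of fun _ _ => C ((hankel μ 0 d).det / (hankel μ 0 (d + 1)).det) * (X 0 - X 1))
    (Matrix.of fun _ j => Sum.elim (lastVec d) (lastVec d) j)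
    (Matrix.of fun i _ => Sum.elim (lastVec d) (lastVec d) i)
    (Matrix.fromBlocks
      ((X 0 : MvPolynomial (Fin 2) ℝ) • constMatrix (hankel μ 0 d) - constMatrix (hankel μ 1 d))
      0
      0
      (-((X 1 : MvPolynomial (Fin 2) ℝ) • constMatrix (hankel μ 0 d))
        + constMatrix (hankel μ 1 d)))

end

/-! Let Λ be the functional sending t^k to m_k. Quadrature rules with d + 1 nodes correspond to
nonzero polynomials g of degree d or d + 1, up to scaling, that are Λ-orthogonal to all polynomials
of degree < d. The real nodes are the zeros of g, and ∞ is a node exactly when deg g = d. Positivity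
of Λ makes these zeros real and simple (`OrthBelow.not_nonneg_dvd`), and interpolation at them gives
positive weights.

The matrix in (a) is the Gram matrix of (p, q) ↦ Λ((t - x)(t - y)pq) on degree < d. So F(x, y) = 0
iff some nonzero p makes (t - x)(t - y)p orthogonal, that is, iff x and y are nodes of one rule. On
the diagonal the form is positive definite, so F(x, x) ≠ 0. If det(xM - M') ≠ 0, there is, up to
scaling, one orthogonal g of degree ≤ d + 1 vanishing at x, and its degree is d + 1; hence the
unique rule through x, with real nodes.

For uniqueness of F, view it over ℝ[x] as a polynomial in y with leading coefficient det(xM - M').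
Generic fibres have d distinct real zeros, so pseudo-division shows that F divides a multiple of any
other node polynomial G by a power of the leading coefficient. That coefficient splits into real
linear factors, none dividing F, so F itself divides G, and equal total degrees make the quotient
constant.

For (b), put A = xM - M' and B = yM - M'. Then M'' - M'M⁻¹M' = δ e eᵀ with δ = det M_d / det
M_{d-1}, so the matrix in (a) is A M⁻¹ B + δ e eᵀ. The matrix determinant lemma, the identity B⁻¹ -
A⁻¹ = (x - y) B⁻¹ M A⁻¹ and a Schur complement of the bordered matrix give the formula where A and B
are invertible. -/

open scoped Polynomial

/-! ### Zeros of orthogonal polynomials -/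

/-- `Λ` is positive on the nonzero polynomials of degree at most `n` that are nonnegative on `ℝ`. -/
def PositiveUpTo (Λ : ℝ[X] →ₗ[ℝ] ℝ) (n : ℕ) : Prop :=
  ∀ f : ℝ[X], f ≠ 0 → f.natDegree ≤ n → (∀ t, 0 ≤ f.eval t) → 0 < Λ f

/-- `g` is `Λ`-orthogonal to all polynomials of degree less than `n`. -/
def OrthBelow (Λ : ℝ[X] →ₗ[ℝ] ℝ) (n : ℕ) (g : ℝ[X]) : Prop :=
  ∀ q : ℝ[X], q.degree < n → Λ (g * q) = 0

lemma PositiveUpTo.mul_self {Λ : ℝ[X] →ₗ[ℝ] ℝ} {d : ℕ} (hΛ : PositiveUpTo Λ (2 * d))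
    {p : ℝ[X]} (hp : p ≠ 0) (hd : p.natDegree ≤ d) : 0 < Λ (p * p) := by
  refine hΛ _ (mul_ne_zero hp hp) ?_ fun t => ?_
  · rw [Polynomial.natDegree_mul hp hp]; omega
  · rw [Polynomial.eval_mul]; exact mul_self_nonneg _

/-- An orthogonal polynomial has no nonnegative quadratic factor. -/
lemma OrthBelow.not_nonneg_dvd {Λ : ℝ[X] →ₗ[ℝ] ℝ} {d : ℕ} (hΛ : PositiveUpTo Λ (2 * d))
    {g : ℝ[X]} (hg0 : g ≠ 0) (hg : g.natDegree ≤ d + 1) (ho : OrthBelow Λ d g)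
    {h : ℝ[X]} (hdeg : h.natDegree = 2) (hnn : ∀ t, 0 ≤ h.eval t) : ¬ h ∣ g := by
  rintro ⟨q, rfl⟩
  have hh : h ≠ 0 := left_ne_zero_of_mul hg0
  have hq : q ≠ 0 := right_ne_zero_of_mul hg0
  rw [Polynomial.natDegree_mul hh hq] at hg
  -- The cofactor q has degree < d, so orthogonality kills Λ(h q²), although h q² is nonnegative.
  have h1 : Λ (h * q * q) = 0 :=
    ho q ((Polynomial.natDegree_lt_iff_degree_lt hq).1 (by omega))
  have h2 : 0 < Λ (h * q * q) := by
    refine hΛ _ (mul_ne_zero hg0 hq) ?_ fun t => ?_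
    · rw [Polynomial.natDegree_mul hg0 hq, Polynomial.natDegree_mul hh hq]; omega
    · rw [mul_assoc, Polynomial.eval_mul, Polynomial.eval_mul]
      exact mul_nonneg (hnn t) (mul_self_nonneg _)
  linarith

/-- In lower degree g could be paired with itself, giving Λ(g²) = 0. -/
lemma OrthBelow.le_natDegree {Λ : ℝ[X] →ₗ[ℝ] ℝ} {d : ℕ} (hΛ : PositiveUpTo Λ (2 * d))
    {g : ℝ[X]} (hg0 : g ≠ 0) (ho : OrthBelow Λ d g) : d ≤ g.natDegree := by
  by_contra! hlt
  have := hΛ.mul_self hg0 hlt.le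
  rw [ho g ((Polynomial.natDegree_lt_iff_degree_lt hg0).1 hlt)] at this
  exact lt_irrefl _ this

/-- A multiple zero a would give the nonnegative factor (t - a)². -/
lemma OrthBelow.nodup_roots {Λ : ℝ[X] →ₗ[ℝ] ℝ} {d : ℕ} (hΛ : PositiveUpTo Λ (2 * d))
    {g : ℝ[X]} (hg0 : g ≠ 0) (hg : g.natDegree ≤ d + 1) (ho : OrthBelow Λ d g) :
    g.roots.Nodup := by
  rw [Multiset.nodup_iff_count_le_one]
  intro a
  rw [Polynomial.count_roots]
  by_contra! hlt
  refine ho.not_nonneg_dvd hΛ hg0 hg (h := (Polynomial.X - Polynomial.C a) ^ 2) ?_ ?_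
    ((Polynomial.le_rootMultiplicity_iff hg0).1 hlt)
  · simp
  · intro t; simp only [Polynomial.eval_pow]; exact sq_nonneg _

/-- A non-real zero and its conjugate would give the nonnegative factor (t - Re z)² + (Im z)². -/
lemma OrthBelow.splits {Λ : ℝ[X] →ₗ[ℝ] ℝ} {d : ℕ} (hΛ : PositiveUpTo Λ (2 * d))
    {g : ℝ[X]} (hg0 : g ≠ 0) (hg : g.natDegree ≤ d + 1) (ho : OrthBelow Λ d g) :
    g.Splits := by
  refine Polynomial.Splits.of_splits_map_of_injective (i := algebraMap ℝ ℂ)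
    (algebraMap ℝ ℂ).injective (IsAlgClosed.splits _) ?_
  intro z hz
  rw [Polynomial.mem_roots (by simpa using hg0), Polynomial.IsRoot, Polynomial.eval_map_algebraMap]
    at hz
  by_cases him : z.im = 0
  · exact ⟨z.re, by apply Complex.ext <;> simp [him]⟩
  · exfalso
    refine ho.not_nonneg_dvd hΛ hg0 hg ?_ ?_
      (Polynomial.quadratic_dvd_of_aeval_eq_zero_im_ne_zero g hz him)
    · compute_degree!
    · intro t
      have : ‖z‖ ^ 2 = z.re ^ 2 + z.im ^ 2 := by
        rw [← Complex.normSq_eq_norm_sq, Complex.normSq_apply]; ring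
      simp only [Polynomial.eval_add, Polynomial.eval_sub, Polynomial.eval_pow, Polynomial.eval_X,
        Polynomial.eval_mul, Polynomial.eval_C, this]
      nlinarith [sq_nonneg (t - z.re), sq_nonneg z.im]

/-! ### Interpolatory quadrature -/

/-- The monic polynomial with simple zeros at the points of `S`. -/
noncomputable def rootPoly (S : Finset ℝ) : ℝ[X] := ∏ s ∈ S, (Polynomial.X - Polynomial.C s)

lemma rootPoly_monic (S : Finset ℝ) : (rootPoly S).Monic :=
  Polynomial.monic_prod_of_monic _ _ fun s _ => Polynomial.monic_X_sub_C s

lemma rootPoly_natDegree (S : Finset ℝ) : (rootPoly S).natDegree = S.card := by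
  simp [rootPoly, Polynomial.natDegree_prod_of_monic, Polynomial.monic_X_sub_C]

lemma rootPoly_eval {S : Finset ℝ} {s : ℝ} : (rootPoly S).eval s = 0 ↔ s ∈ S := by
  rw [rootPoly, Polynomial.eval_prod, Finset.prod_eq_zero_iff]
  simp [sub_eq_zero]

/-- Up to a factor, an orthogonal polynomial of degree at most `d + 1` is a `rootPoly`. -/
lemma OrthBelow.exists_rootPoly {Λ : ℝ[X] →ₗ[ℝ] ℝ} {d : ℕ} (hΛ : PositiveUpTo Λ (2 * d))
    {g : ℝ[X]} (hg0 : g ≠ 0) (hg : g.natDegree ≤ d + 1) (ho : OrthBelow Λ d g) :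
    ∃ S : Finset ℝ, S.card = g.natDegree ∧ (∀ s, s ∈ S ↔ g.eval s = 0) ∧
      OrthBelow Λ d (rootPoly S) := by
  classical
  have hn := ho.nodup_roots hΛ hg0 hg
  have hs := ho.splits hΛ hg0 hg
  have hr : g = Polynomial.C g.leadingCoeff * rootPoly ⟨g.roots, hn⟩ := by
    exact hs.eq_prod_roots
  refine ⟨⟨g.roots, hn⟩, Polynomial.splits_iff_card_roots.1 hs, fun s => ?_, fun q hq => ?_⟩
  · simp [Polynomial.mem_roots hg0]
  · have h1 := ho q hq
    rw [hr, mul_assoc, ← Polynomial.smul_eq_C_mul, map_smul, smul_eq_mul] at h1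
    exact (mul_eq_zero.1 h1).resolve_left (by simpa using hg0)

/-- Interpolatory quadrature at the zeros of an orthogonal polynomial. -/
lemma OrthBelow.apply_eq_sum {Λ : ℝ[X] →ₗ[ℝ] ℝ} {d : ℕ} {S : Finset ℝ}
    (ho : OrthBelow Λ d (rootPoly S)) {f : ℝ[X]} (hf : f.natDegree < S.card + d) :
    Λ f = ∑ s ∈ S, f.eval s * Λ (Lagrange.basis S id s) := by
  have hm := rootPoly_monic S
  -- Modulo `rootPoly S`, f is its interpolant on S; the multiple of `rootPoly S` is then killed by
  -- orthogonality.
  have h1 : f %ₘ rootPoly S = Lagrange.interpolate S id fun s => f.eval s := by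
    refine Lagrange.eq_interpolate_of_eval_eq _ Function.injective_id.injOn ?_ fun s hs => ?_
    · refine (Polynomial.degree_modByMonic_lt f hm).trans_eq ?_
      rw [Polynomial.degree_eq_natDegree hm.ne_zero, rootPoly_natDegree]
    · have := congrArg (Polynomial.eval s) (Polynomial.modByMonic_add_div f (rootPoly S))
      rw [Polynomial.eval_add, Polynomial.eval_mul, rootPoly_eval.2 hs, zero_mul, add_zero] at this
      exact this
  have h2 : Λ (rootPoly S * (f /ₘ rootPoly S)) = 0 := by
    by_cases h0 : f /ₘ rootPoly S = 0
    · rw [h0, mul_zero, map_zero]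
    refine ho _ ((Polynomial.natDegree_lt_iff_degree_lt h0).1 ?_)
    rw [Polynomial.natDegree_divByMonic f hm, rootPoly_natDegree]
    have : (rootPoly S).natDegree ≤ f.natDegree := by
      by_contra! hlt
      exact h0 ((Polynomial.divByMonic_eq_zero_iff hm).2 (Polynomial.degree_lt_degree hlt))
    rw [rootPoly_natDegree] at this
    rcases Nat.eq_zero_or_pos d with rfl | hd <;> omega
  conv_lhs => rw [← Polynomial.modByMonic_add_div f (rootPoly S)]
  rw [map_add, h2, add_zero, h1, Lagrange.interpolate_apply, map_sum]
  refine Finset.sum_congr rfl fun s _ => ?_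
  rw [← Polynomial.smul_eq_C_mul, map_smul, smul_eq_mul]

/-- The square of the basis polynomial has degree 2(|S| - 1) < |S| + d, so quadrature is exact on it
and identifies the weight with Λ(ℓ_s²) > 0. -/
lemma OrthBelow.basis_pos {Λ : ℝ[X] →ₗ[ℝ] ℝ} {d : ℕ} (hΛ : PositiveUpTo Λ (2 * d))
    {S : Finset ℝ} (hS : S.card ≤ d + 1)
    (ho : OrthBelow Λ d (rootPoly S)) {s : ℝ} (hs : s ∈ S) :
    0 < Λ (Lagrange.basis S id s) := by
  have hinj : Set.InjOn (id : ℝ → ℝ) S := Function.injective_id.injOn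
  have hb := Lagrange.natDegree_basis hinj hs
  have hb0 := Lagrange.basis_ne_zero hinj hs
  have hc := Finset.card_pos.2 ⟨s, hs⟩
  have hpos := hΛ.mul_self hb0 (by omega)
  rw [ho.apply_eq_sum (by rw [Polynomial.natDegree_mul hb0 hb0]; omega),
    Finset.sum_eq_single_of_mem s hs] at hpos
  · have h1 := Lagrange.eval_basis_self hinj hs
    simp only [id] at h1
    simpa [Polynomial.eval_mul, h1] using hpos
  · intro t ht hts
    have h1 := Lagrange.eval_basis_of_ne (v := (id : ℝ → ℝ)) hts.symm ht
    simp only [id] at h1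
    rw [Polynomial.eval_mul, h1]; simp

/-! ### Hankel determinants and degenerate bilinear forms -/

/-- The Hankel matrix `(Λ (w t^(i+j)))`. -/
noncomputable def weightedHankel (Λ : ℝ[X] →ₗ[ℝ] ℝ) (w : ℝ[X]) (n : ℕ) : Matrix (Fin n) (Fin n) ℝ :=
  Matrix.of fun i j => Λ (w * Polynomial.X ^ ((i : ℕ) + (j : ℕ)))

/-- The polynomial with coefficient vector `v`. -/
noncomputable def polyOfVec {n : ℕ} (v : Fin n → ℝ) : ℝ[X] := ∑ i : Fin n, Polynomial.monomial (i : ℕ) (v i)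

lemma coeff_polyOfVec {n : ℕ} (v : Fin n → ℝ) (i : Fin n) : (polyOfVec v).coeff i = v i := by
  simp [polyOfVec, Polynomial.coeff_monomial, Fin.val_inj]

lemma polyOfVec_ne_zero {n : ℕ} {v : Fin n → ℝ} (hv : v ≠ 0) : polyOfVec v ≠ 0 := by
  rintro h
  exact hv (funext fun i => by rw [← coeff_polyOfVec v i, h]; simp)

lemma degree_polyOfVec_lt {n : ℕ} (v : Fin n → ℝ) : (polyOfVec v).degree < n :=
  Polynomial.mem_degreeLT.1 (Submodule.sum_mem _ fun i _ => Polynomial.mem_degreeLT.2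
    ((Polynomial.degree_monomial_le _ _).trans_lt (by exact_mod_cast i.2)))

lemma polyOfVec_coeff {n : ℕ} {p : ℝ[X]} (hp : p.degree < n) :
    polyOfVec (fun i : Fin n => p.coeff i) = p :=
  (p.sum_fin (fun i a => Polynomial.monomial i a) (by simp) hp).trans p.sum_monomial_eq

lemma apply_mul_polyOfVec (Λ : ℝ[X] →ₗ[ℝ] ℝ) {n : ℕ} (g : ℝ[X]) (v : Fin n → ℝ) :
    Λ (g * polyOfVec v) = ∑ i, v i * Λ (g * Polynomial.X ^ (i : ℕ)) := by
  rw [polyOfVec, Finset.mul_sum, map_sum]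
  refine Finset.sum_congr rfl fun i _ => ?_
  rw [← Polynomial.smul_X_eq_monomial, mul_smul_comm, map_smul, smul_eq_mul]

lemma orthBelow_iff (Λ : ℝ[X] →ₗ[ℝ] ℝ) (n : ℕ) (g : ℝ[X]) :
    OrthBelow Λ n g ↔ ∀ i : Fin n, Λ (g * Polynomial.X ^ (i : ℕ)) = 0 := by
  refine ⟨fun h i => h _ ?_, fun h q hq => ?_⟩
  · rw [Polynomial.degree_X_pow]; exact_mod_cast i.2
  · rw [← polyOfVec_coeff hq, apply_mul_polyOfVec]
    simp [h]

/-- `det (Λ (w t^(i+j)))` vanishes iff the bilinear form `Λ (w p q)` is degenerate. -/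
lemma det_weightedHankel_eq_zero_iff (Λ : ℝ[X] →ₗ[ℝ] ℝ) (w : ℝ[X]) (n : ℕ) :
    (weightedHankel Λ w n).det = 0 ↔
      ∃ p : ℝ[X], p ≠ 0 ∧ p.degree < n ∧ OrthBelow Λ n (w * p) := by
  have key : ∀ v : Fin n → ℝ, OrthBelow Λ n (w * polyOfVec v) ↔
      (weightedHankel Λ w n).mulVec v = 0 := by
    intro v
    rw [orthBelow_iff, funext_iff]
    refine forall_congr' fun i => ?_
    rw [mul_right_comm, apply_mul_polyOfVec]
    simp only [Matrix.mulVec, dotProduct, weightedHankel, Matrix.of_apply, Pi.zero_apply]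
    simp only [mul_assoc, ← pow_add, mul_comm (v _)]
  rw [← Matrix.exists_mulVec_eq_zero_iff]
  constructor
  · rintro ⟨v, hv, h⟩
    exact ⟨polyOfVec v, polyOfVec_ne_zero hv, degree_polyOfVec_lt v, (key v).2 h⟩
  · rintro ⟨p, hp, hd, ho⟩
    refine ⟨fun i => p.coeff i, fun h => hp ?_, (key _).1 (by rwa [polyOfVec_coeff hd])⟩
    rw [← polyOfVec_coeff hd, h]; simp [polyOfVec]

/-- There is always a nonzero `p` of degree at most `n` with `w p` orthogonal to all polynomials of
degree less than `n`. -/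
lemma exists_orthBelow_mul (Λ : ℝ[X] →ₗ[ℝ] ℝ) (w : ℝ[X]) (n : ℕ) :
    ∃ p : ℝ[X], p ≠ 0 ∧ p.natDegree ≤ n ∧ OrthBelow Λ n (w * p) := by
  let A : Matrix (Fin n) (Fin (n + 1)) ℝ :=
    Matrix.of fun i j => Λ (w * Polynomial.X ^ ((i : ℕ) + (j : ℕ)))
  -- There are n linear conditions on n + 1 coefficients.
  obtain ⟨v, hv, hv0⟩ := (Submodule.ne_bot_iff _).1
    (LinearMap.ker_ne_bot_of_finrank_lt (f := A.mulVecLin) (by simp))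
  refine ⟨polyOfVec v, polyOfVec_ne_zero hv0, ?_, (orthBelow_iff _ _ _).2 fun i => ?_⟩
  · exact Nat.lt_succ_iff.1 ((Polynomial.natDegree_lt_iff_degree_lt (polyOfVec_ne_zero hv0)).2
      (degree_polyOfVec_lt v))
  · have := congrFun (LinearMap.mem_ker.1 hv) i
    rw [mul_right_comm, apply_mul_polyOfVec]
    simp only [A, Matrix.mulVecLin_apply, Matrix.mulVec, dotProduct, Matrix.of_apply,
      Pi.zero_apply] at this
    simpa only [mul_assoc, ← pow_add, mul_comm (v _)] using this

/-- A kernel vector p would give Λ(w p²) = 0. The degree bound says deg w + 2(n - 1) ≤ m without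
truncated subtraction. -/
lemma det_weightedHankel_ne_zero {Λ : ℝ[X] →ₗ[ℝ] ℝ} {m n : ℕ} (hΛ : PositiveUpTo Λ m)
    {w : ℝ[X]} (hw0 : w ≠ 0) (hw : ∀ t, 0 ≤ w.eval t) (hm : w.natDegree + 2 * n ≤ m + 2) :
    (weightedHankel Λ w n).det ≠ 0 := by
  rw [Ne, det_weightedHankel_eq_zero_iff]
  rintro ⟨p, hp, hd, ho⟩
  have hd' := (Polynomial.natDegree_lt_iff_degree_lt hp).2 hd
  refine (hΛ (w * p * p) (mul_ne_zero (mul_ne_zero hw0 hp) hp) ?_ fun t => ?_).ne' (ho p hd)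
  · rw [mul_assoc, Polynomial.natDegree_mul hw0 (mul_ne_zero hp hp), Polynomial.natDegree_mul hp hp]
    omega
  · rw [mul_assoc, Polynomial.eval_mul, Polynomial.eval_mul]
    exact mul_nonneg (hw t) (mul_self_nonneg _)

/-! ### The moment functional -/

/-- The linear functional on polynomials sending `t ^ k` to the `k`-th moment of `μ`. -/
noncomputable def momentFunctional (μ : Measure ℝ) : ℝ[X] →ₗ[ℝ] ℝ :=
  Polynomial.lsum fun k => LinearMap.toSpanSingleton ℝ ℝ (∫ t : ℝ, t ^ k ∂μ)

lemma momentFunctional_X_pow (μ : Measure ℝ) (k : ℕ) :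
    momentFunctional μ (Polynomial.X ^ k) = ∫ t : ℝ, t ^ k ∂μ := by
  rw [← Polynomial.monomial_one_right_eq_X_pow, momentFunctional, Polynomial.lsum_apply,
    Polynomial.sum_monomial_index] <;> simp

/-- Above degree D, non-integrable powers enter the functional with the default integral 0, hence
the degree bound. -/
lemma momentFunctional_eq_integral {μ : Measure ℝ} {D : ℕ} (h : HasFiniteMoments μ D)
    {f : ℝ[X]} (hf : f.natDegree ≤ D) : momentFunctional μ f = ∫ t, f.eval t ∂μ := by
  have h1 : ∀ t, f.eval t = ∑ k ∈ Finset.range (D + 1), f.coeff k * t ^ k := fun t =>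
    Polynomial.eval_eq_sum_range' (Nat.lt_succ_iff.2 hf) t
  simp_rw [h1]
  rw [integral_finsetSum _ fun k hk =>
    (h k (Nat.lt_succ_iff.1 (Finset.mem_range.1 hk))).const_mul _]
  simp_rw [integral_const_mul, ← momentFunctional_X_pow]
  conv_lhs => rw [f.as_sum_range_C_mul_X_pow' (Nat.lt_succ_iff.2 hf)]
  rw [map_sum]
  refine Finset.sum_congr rfl fun k _ => ?_
  rw [← Polynomial.smul_eq_C_mul, map_smul, smul_eq_mul]

lemma NonDegenerate.positiveUpTo {μ : Measure ℝ} {d : ℕ} (h : NonDegenerate μ d) :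
    PositiveUpTo (momentFunctional μ) (2 * d) := fun f h0 hd hnn => by
  rw [momentFunctional_eq_integral h.1 hd]
  exact h.2 f h0 hd hnn

/-! ### Quadrature rules and orthogonal polynomials -/

/-- The real nodes among a finite set of nodes. -/
noncomputable def realNodes (N : Finset (OnePoint ℝ)) : Finset ℝ :=
  N.preimage (fun x : ℝ => (x : OnePoint ℝ)) OnePoint.coe_injective.injOn

lemma mem_realNodes {N : Finset (OnePoint ℝ)} {x : ℝ} : x ∈ realNodes N ↔ (x : OnePoint ℝ) ∈ N :=
  Finset.mem_preimage

/-- The inclusion of the real line into `ℝ ∪ {∞}`. -/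
def realEmb : ℝ ↪ OnePoint ℝ := ⟨fun x => (x : OnePoint ℝ), OnePoint.coe_injective⟩

lemma infty_notMem_map (S : Finset ℝ) : OnePoint.infty ∉ S.map realEmb := by
  simp [realEmb]

lemma eq_map_realNodes {N : Finset (OnePoint ℝ)} (h : OnePoint.infty ∉ N) :
    N = (realNodes N).map realEmb := by
  ext x
  induction x using OnePoint.rec with
  | infty => simp [h, realEmb]
  | coe x => simp [realEmb, mem_realNodes]

lemma eq_cons_realNodes {N : Finset (OnePoint ℝ)} (h : OnePoint.infty ∈ N) :
    N = ((realNodes N).map realEmb).cons OnePoint.infty (infty_notMem_map _) := by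
  ext x
  induction x using OnePoint.rec with
  | infty => simp [h]
  | coe x => simp [realEmb, mem_realNodes]

lemma card_eq_of_infty_notMem {N : Finset (OnePoint ℝ)} (h : OnePoint.infty ∉ N) :
    N.card = (realNodes N).card := by
  conv_lhs => rw [eq_map_realNodes h]
  simp

lemma card_eq_of_infty_mem {N : Finset (OnePoint ℝ)} (h : OnePoint.infty ∈ N) :
    N.card = (realNodes N).card + 1 := by
  conv_lhs => rw [eq_cons_realNodes h]
  simp

lemma evalAt_coe (D : ℕ) (x : ℝ) (f : ℝ[X]) : evalAt D (x : OnePoint ℝ) f = f.eval x := rfl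

lemma evalAt_infty (D : ℕ) (f : ℝ[X]) : evalAt D OnePoint.infty f = f.coeff D := rfl

namespace QuadratureRule

variable {μ : Measure ℝ} {D d : ℕ}

lemma momentFunctional_eq (R : QuadratureRule μ D) {f : ℝ[X]} (hf : f.natDegree ≤ D) :
    momentFunctional μ f = ∑ x : R.nodes, R.weight x * evalAt D x f := by
  rw [momentFunctional_eq_integral R.finite_moments hf, R.exact f hf]

lemma momentFunctional_eq_zero (R : QuadratureRule μ D) {f : ℝ[X]} (hf : f.natDegree ≤ D)
    (hr : ∀ x ∈ realNodes R.nodes, f.eval x = 0)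
    (hi : OnePoint.infty ∈ R.nodes → f.coeff D = 0) : momentFunctional μ f = 0 := by
  rw [R.momentFunctional_eq hf]
  refine Finset.sum_eq_zero fun ⟨x, hx⟩ _ => ?_
  induction x using OnePoint.rec with
  | infty => rw [evalAt_infty, hi hx, mul_zero]
  | coe x => rw [evalAt_coe, hr x (mem_realNodes.2 hx), mul_zero]

/-- A quadrature rule of degree `2d` has at least `d + 1` nodes. -/
lemma lt_card (R : QuadratureRule μ (2 * d)) (hΛ : PositiveUpTo (momentFunctional μ) (2 * d)) :
    d < R.nodes.card := by
  by_contra! hle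
  have h0 := (rootPoly_monic (realNodes R.nodes)).ne_zero
  have hdeg := Polynomial.natDegree_mul h0 h0
  rw [rootPoly_natDegree] at hdeg
  have hle' : (realNodes R.nodes).card ≤ d := by
    by_cases hi : OnePoint.infty ∈ R.nodes
    · have := card_eq_of_infty_mem hi; omega
    · have := card_eq_of_infty_notMem hi; omega
  -- With at most d nodes, the square of the node polynomial would integrate to zero; if ∞ is a
  -- node, its degree is < 2d, so the value at ∞ vanishes too.
  refine (hΛ.mul_self h0 (by rwa [rootPoly_natDegree])).ne' ?_
  refine R.momentFunctional_eq_zero (by omega) (fun x hx => ?_) fun hi => ?_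
  · rw [Polynomial.eval_mul, rootPoly_eval.2 hx, zero_mul]
  · have := card_eq_of_infty_mem hi
    exact Polynomial.coeff_eq_zero_of_natDegree_lt (by omega)

lemma isGaussian_of_card (R : QuadratureRule μ (2 * d))
    (hΛ : PositiveUpTo (momentFunctional μ) (2 * d)) (hR : R.nodes.card = d + 1) :
    R.IsGaussian := fun R' => by
  have := R'.lt_card hΛ
  omega

/-- The real nodes of a rule with `d + 1` nodes are the zeros of an orthogonal polynomial. -/
lemma orthBelow (R : QuadratureRule μ (2 * d)) (hR : R.nodes.card = d + 1) :
    OrthBelow (momentFunctional μ) d (rootPoly (realNodes R.nodes)) := by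
  intro q hq
  by_cases hq0 : q = 0
  · rw [hq0, mul_zero, map_zero]
  have h0 := (rootPoly_monic (realNodes R.nodes)).ne_zero
  have hdeg := Polynomial.natDegree_mul h0 hq0
  have hq' := (Polynomial.natDegree_lt_iff_degree_lt hq0).2 hq
  rw [rootPoly_natDegree] at hdeg
  refine R.momentFunctional_eq_zero ?_ (fun x hx => ?_) fun hi => ?_
  · by_cases hi : OnePoint.infty ∈ R.nodes
    · have := card_eq_of_infty_mem hi; omega
    · have := card_eq_of_infty_notMem hi; omega
  · rw [Polynomial.eval_mul, rootPoly_eval.2 hx, zero_mul]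
  -- If ∞ is a node there are only d real nodes, so the product has degree < 2d.
  · have := card_eq_of_infty_mem hi
    exact Polynomial.coeff_eq_zero_of_natDegree_lt (by omega)

/-- A quadrature rule given by a weight function defined on all of `ℝ ∪ {∞}`. -/
lemma exists_of_weight (hμ : HasFiniteMoments μ D) (N : Finset (OnePoint ℝ)) (W : OnePoint ℝ → ℝ)
    (hW : ∀ x ∈ N, 0 < W x)
    (h : ∀ f : ℝ[X], f.natDegree ≤ D → momentFunctional μ f = ∑ x ∈ N, W x * evalAt D x f) :
    ∃ R : QuadratureRule μ D, R.nodes = N :=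
  ⟨{ nodes := N
     weight := fun x => W x
     weight_pos := fun x => hW x x.2
     finite_moments := hμ
     exact := fun f hf => by
      rw [← momentFunctional_eq_integral hμ hf, h f hf]
      exact (Finset.sum_coe_sort N fun x => W x * evalAt D x f).symm }, rfl⟩

lemma exists_nodes_real (hμ : NonDegenerate μ d) {S : Finset ℝ} (hS : S.card = d + 1)
    (ho : OrthBelow (momentFunctional μ) d (rootPoly S)) :
    ∃ R : QuadratureRule μ (2 * d), R.nodes = S.map realEmb := by
  refine exists_of_weight hμ.1 _
    (fun x => OnePoint.rec 0 (fun s => momentFunctional μ (Lagrange.basis S id s)) x)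
    (fun x hx => ?_) fun f hf => ?_
  · obtain ⟨s, hs, rfl⟩ := Finset.mem_map.1 hx
    exact ho.basis_pos hμ.positiveUpTo hS.le hs
  · rw [ho.apply_eq_sum (by omega), Finset.sum_map]
    exact Finset.sum_congr rfl fun s _ => mul_comm _ _

/-- Interpolation at d points is exact only below degree 2d. Subtracting f_{2d} times the square of
the node polynomial removes the top term without changing values at the nodes; so the weight at ∞ is
the Λ-value of that square. -/
lemma exists_nodes_infty (hμ : NonDegenerate μ d) {S : Finset ℝ} (hS : S.card = d)
    (ho : OrthBelow (momentFunctional μ) d (rootPoly S)) :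
    ∃ R : QuadratureRule μ (2 * d),
      R.nodes = (S.map realEmb).cons OnePoint.infty (infty_notMem_map S) := by
  have hΛ := hμ.positiveUpTo
  have hm := rootPoly_monic S
  have hd := rootPoly_natDegree S
  refine exists_of_weight hμ.1 _
    (fun x => OnePoint.rec (momentFunctional μ (rootPoly S * rootPoly S))
      (fun s => momentFunctional μ (Lagrange.basis S id s)) x)
    (fun x hx => ?_) fun f hf => ?_
  · rcases Finset.mem_cons.1 hx with rfl | hx
    · exact hΛ.mul_self hm.ne_zero (by omega)
    · obtain ⟨s, hs, rfl⟩ := Finset.mem_map.1 hx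
      exact ho.basis_pos hΛ (by omega) hs
  · rw [Finset.sum_cons, Finset.sum_map]
    have hev : ∀ s ∈ S, (f - f.coeff (2 * d) • (rootPoly S * rootPoly S)).eval s = f.eval s := by
      intro s hs
      simp [rootPoly_eval.2 hs]
    have hsplit : f = (f - f.coeff (2 * d) • (rootPoly S * rootPoly S)) +
      f.coeff (2 * d) • (rootPoly S * rootPoly S) := by ring
    have hmm : (rootPoly S * rootPoly S).coeff (2 * d) = 1 := by
      have := (hm.mul hm).coeff_natDegree
      rwa [hm.natDegree_mul hm, hd, hS, ← two_mul] at this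
    have hle : (f - f.coeff (2 * d) • (rootPoly S * rootPoly S)).natDegree ≤ 2 * d := by
      refine (Polynomial.natDegree_sub_le _ _).trans (max_le hf ?_)
      refine (Polynomial.natDegree_smul_le _ _).trans ?_
      rw [hm.natDegree_mul hm]; omega
    have hc : (f - f.coeff (2 * d) • (rootPoly S * rootPoly S)).coeff (2 * d) = 0 := by
      rw [Polynomial.coeff_sub, Polynomial.coeff_smul, hmm]; simp
    have key : momentFunctional μ (f - f.coeff (2 * d) • (rootPoly S * rootPoly S)) =
        ∑ s ∈ S, f.eval s * momentFunctional μ (Lagrange.basis S id s) := by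
      -- If the degree were 2d, the vanishing coefficient there would force the difference to be
      -- zero.
      rcases hle.lt_or_eq with hlt | heq
      · rw [ho.apply_eq_sum (by omega)]
        exact Finset.sum_congr rfl fun s hs => by rw [hev s hs]
      · have h0 : f - f.coeff (2 * d) • (rootPoly S * rootPoly S) = 0 := by
          rw [← Polynomial.leadingCoeff_eq_zero, Polynomial.leadingCoeff, heq, hc]
        rw [h0, map_zero]
        refine (Finset.sum_eq_zero fun s hs => ?_).symm
        rw [← hev s hs, h0]; simp
    conv_lhs => rw [hsplit]
    rw [map_add, key, map_smul, smul_eq_mul, add_comm]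
    refine congrArg₂ _ (mul_comm _ _) (Finset.sum_congr rfl fun s _ => mul_comm _ _)

/-- A nonzero orthogonal polynomial of degree at most `d + 1` yields a quadrature rule. -/
lemma exists_of_orthBelow (hμ : NonDegenerate μ d) {g : ℝ[X]} (hg0 : g ≠ 0)
    (hg : g.natDegree ≤ d + 1) (ho : OrthBelow (momentFunctional μ) d g) :
    ∃ R : QuadratureRule μ (2 * d), R.IsGaussian ∧ R.nodes.card = d + 1 ∧
      ∀ x : ℝ, (x : OnePoint ℝ) ∈ R.nodes ↔ g.eval x = 0 := by
  have hΛ := hμ.positiveUpTo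
  obtain ⟨S, hcard, hS, hoS⟩ := ho.exists_rootPoly hΛ hg0 hg
  have hle := ho.le_natDegree hΛ hg0
  obtain h | h : S.card = d + 1 ∨ S.card = d := by omega
  · obtain ⟨R, hR⟩ := exists_nodes_real hμ h hoS
    have hc : R.nodes.card = d + 1 := by rw [hR]; simpa
    refine ⟨R, R.isGaussian_of_card hΛ hc, hc, fun x => ?_⟩
    rw [hR, ← hS]; simp [realEmb]
  · obtain ⟨R, hR⟩ := exists_nodes_infty hμ h hoS
    have hc : R.nodes.card = d + 1 := by rw [hR]; simpa
    refine ⟨R, R.isGaussian_of_card hΛ hc, hc, fun x => ?_⟩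
    rw [hR, ← hS]; simp [realEmb]

/-- A rule of degree at least `n - 1` with `n` real nodes is determined by its nodes. -/
lemma ext_of_nodes {R R' : QuadratureRule μ D} (h : R.nodes = R'.nodes)
    (hi : OnePoint.infty ∉ R.nodes) (hc : R.nodes.card ≤ D + 1) : R = R' := by
  have hw : ∀ (R : QuadratureRule μ D), OnePoint.infty ∉ R.nodes → R.nodes.card ≤ D + 1 →
      ∀ x : R.nodes, ∀ s : ℝ, (x : OnePoint ℝ) = s → R.weight x =
        momentFunctional μ (Lagrange.basis (realNodes R.nodes) id s) := by
    intro R hi hc x s hxs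
    have hs : s ∈ realNodes R.nodes := mem_realNodes.2 (hxs ▸ x.2)
    have hinj : Set.InjOn (id : ℝ → ℝ) (realNodes R.nodes) := Function.injective_id.injOn
    -- Exactness on the Lagrange basis polynomial at s, of degree |N| - 1 ≤ D, isolates the weight
    -- at s.
    rw [R.momentFunctional_eq (by
      rw [Lagrange.natDegree_basis hinj hs, ← card_eq_of_infty_notMem hi]; omega),
      Finset.sum_eq_single x]
    · have h1 := Lagrange.eval_basis_self hinj hs
      simp only [id] at h1
      rw [hxs, evalAt_coe, h1, mul_one]
    · rintro ⟨y, hy⟩ _ hne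
      induction y using OnePoint.rec with
      | infty => exact absurd hy hi
      | coe y =>
        have hys : s ≠ y := by
          rintro rfl; exact hne (Subtype.ext hxs.symm)
        have h1 := Lagrange.eval_basis_of_ne (v := (id : ℝ → ℝ)) hys (mem_realNodes.2 hy)
        simp only [id] at h1
        rw [evalAt_coe, h1, mul_zero]
    · simp
  obtain ⟨N, w, hwp, hm, hex⟩ := R
  obtain ⟨N', w', hwp', hm', hex'⟩ := R'
  obtain rfl : N = N' := h
  congr 1
  funext ⟨x, hx⟩
  induction x using OnePoint.rec with
  | infty => exact absurd hx hi
  | coe x =>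
    exact (hw ⟨N, w, hwp, hm, hex⟩ hi hc ⟨x, hx⟩ x rfl).trans
      (hw ⟨N, w', hwp', hm', hex'⟩ hi hc ⟨x, hx⟩ x rfl).symm

end QuadratureRule

/-! ### Hankel determinants and nodes of Gaussian rules -/

/-- `x M - M'` as a weighted Hankel matrix. -/
lemma smul_hankel_sub (μ : Measure ℝ) (d : ℕ) (x : ℝ) :
    x • hankel μ 0 d - hankel μ 1 d =
      weightedHankel (momentFunctional μ) (Polynomial.C x - Polynomial.X) d := by
  ext i j
  simp only [hankel, weightedHankel, Matrix.sub_apply, Matrix.smul_apply, Matrix.of_apply,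
    ← momentFunctional_X_pow, smul_eq_mul, sub_mul, map_sub]
  rw [← Polynomial.smul_eq_C_mul, map_smul, smul_eq_mul, ← pow_succ', add_zero]

lemma smul_hankel_add (μ : Measure ℝ) (d : ℕ) (x y : ℝ) :
    (x * y) • hankel μ 0 d - (x + y) • hankel μ 1 d + hankel μ 2 d =
      weightedHankel (momentFunctional μ)
        ((Polynomial.X - Polynomial.C x) * (Polynomial.X - Polynomial.C y)) d := by
  ext i j
  have : ((Polynomial.X - Polynomial.C x) * (Polynomial.X - Polynomial.C y)) *
      Polynomial.X ^ ((i : ℕ) + (j : ℕ)) = (x * y) • Polynomial.X ^ ((i : ℕ) + (j : ℕ) + 0)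
        - (x + y) • Polynomial.X ^ ((i : ℕ) + (j : ℕ) + 1)
        + (Polynomial.X ^ ((i : ℕ) + (j : ℕ) + 2) : ℝ[X]) := by
    simp only [Polynomial.smul_eq_C_mul, map_mul, map_add]
    ring
  simp only [hankel, weightedHankel, Matrix.sub_apply, Matrix.add_apply, Matrix.smul_apply,
    Matrix.of_apply, this, map_add, map_sub, map_smul, momentFunctional_X_pow]

lemma hankel_zero_eq (μ : Measure ℝ) (d : ℕ) :
    hankel μ 0 d = weightedHankel (momentFunctional μ) 1 d := by
  ext i j
  simp [hankel, weightedHankel, momentFunctional_X_pow]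

lemma NonDegenerate.det_hankel_ne_zero {μ : Measure ℝ} {d n : ℕ} (h : NonDegenerate μ d)
    (hn : n ≤ d + 1) : (hankel μ 0 n).det ≠ 0 := by
  rw [hankel_zero_eq]
  exact det_weightedHankel_ne_zero h.positiveUpTo one_ne_zero (by simp)
    (by rw [Polynomial.natDegree_one]; omega)

/-- Zeros of `det (x M - M')`: the zeros of orthogonal polynomials of degree at most `d`. -/
lemma det_smul_hankel_sub_eq_zero {μ : Measure ℝ} {d : ℕ} {x : ℝ} {p : ℝ[X]} (hp : p ≠ 0)
    (hd : p.natDegree < d)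
    (ho : OrthBelow (momentFunctional μ) d ((Polynomial.X - Polynomial.C x) * p)) :
    (x • hankel μ 0 d - hankel μ 1 d).det = 0 := by
  rw [smul_hankel_sub, det_weightedHankel_eq_zero_iff]
  refine ⟨p, hp, (Polynomial.natDegree_lt_iff_degree_lt hp).1 hd, fun q hq => ?_⟩
  have := ho q hq
  rw [← neg_sub, neg_mul, neg_mul, map_neg, this, neg_zero]

/-- The weight (t - x)² is nonnegative. This both forces the two nodes to be distinct and keeps F
from vanishing on a whole fibre. -/
lemma NonDegenerate.det_bilinear_self_ne_zero {μ : Measure ℝ} {d : ℕ} (h : NonDegenerate μ d)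
    (x : ℝ) :
    ((x * x) • hankel μ 0 d - (x + x) • hankel μ 1 d + hankel μ 2 d).det ≠ 0 := by
  rw [smul_hankel_add]
  refine det_weightedHankel_ne_zero h.positiveUpTo
    (mul_ne_zero (Polynomial.X_sub_C_ne_zero x) (Polynomial.X_sub_C_ne_zero x)) (fun t => ?_) ?_
  · rw [Polynomial.eval_mul]; exact mul_self_nonneg _
  · rw [Polynomial.natDegree_mul (Polynomial.X_sub_C_ne_zero x) (Polynomial.X_sub_C_ne_zero x),
      Polynomial.natDegree_X_sub_C]
    omega

/-- The two-node determinant vanishes at `(x, y)` iff some nonzero orthogonal polynomial of degree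
at most `d + 1` is divisible by `(t - x) (t - y)`. -/
lemma det_bilinear_eq_zero_iff {μ : Measure ℝ} {d : ℕ} {x y : ℝ} :
    ((x * y) • hankel μ 0 d - (x + y) • hankel μ 1 d + hankel μ 2 d).det = 0 ↔
      ∃ g : ℝ[X], g ≠ 0 ∧ g.natDegree ≤ d + 1 ∧ OrthBelow (momentFunctional μ) d g ∧
        (Polynomial.X - Polynomial.C x) * (Polynomial.X - Polynomial.C y) ∣ g := by
  have hw : (Polynomial.X - Polynomial.C x) * (Polynomial.X - Polynomial.C y) ≠ 0 :=
    mul_ne_zero (Polynomial.X_sub_C_ne_zero x) (Polynomial.X_sub_C_ne_zero y)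
  have hwd : ((Polynomial.X - Polynomial.C x) * (Polynomial.X - Polynomial.C y)).natDegree = 2 := by
    rw [Polynomial.natDegree_mul (Polynomial.X_sub_C_ne_zero x) (Polynomial.X_sub_C_ne_zero y),
      Polynomial.natDegree_X_sub_C, Polynomial.natDegree_X_sub_C]
  rw [smul_hankel_add, det_weightedHankel_eq_zero_iff]
  constructor
  · rintro ⟨p, hp, hpd, ho⟩
    have := (Polynomial.natDegree_lt_iff_degree_lt hp).2 hpd
    exact ⟨_, mul_ne_zero hw hp, by rw [Polynomial.natDegree_mul hw hp]; omega, ho, p, rfl⟩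
  · rintro ⟨g, hg0, hgd, ho, p, rfl⟩
    have hp := right_ne_zero_of_mul hg0
    rw [Polynomial.natDegree_mul hw hp] at hgd
    exact ⟨p, hp, (Polynomial.natDegree_lt_iff_degree_lt hp).1 (by omega), ho⟩

/-- The two-node determinant vanishes exactly at the pairs of nodes of a Gaussian rule. -/
lemma NonDegenerate.det_bilinear_eq_zero_iff_exists_rule {μ : Measure ℝ} {d : ℕ}
    (h : NonDegenerate μ d) (x y : ℝ) :
    ((x * y) • hankel μ 0 d - (x + y) • hankel μ 1 d + hankel μ 2 d).det = 0 ↔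
      ∃ R : QuadratureRule μ (2 * d), R.IsGaussian ∧ R.nodes.card = d + 1 ∧
        x ≠ y ∧ (x : OnePoint ℝ) ∈ R.nodes ∧ (y : OnePoint ℝ) ∈ R.nodes := by
  constructor
  · intro h0
    have hxy : x ≠ y := by
      rintro rfl; exact h.det_bilinear_self_ne_zero x h0
    obtain ⟨g, hg0, hgd, ho, p, rfl⟩ := det_bilinear_eq_zero_iff.1 h0
    obtain ⟨R, hR, hc, hn⟩ := QuadratureRule.exists_of_orthBelow h hg0 hgd ho
    exact ⟨R, hR, hc, hxy, (hn x).2 (by simp), (hn y).2 (by simp)⟩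
  · rintro ⟨R, -, hc, hxy, hx, hy⟩
    refine det_bilinear_eq_zero_iff.2 ⟨_, (rootPoly_monic _).ne_zero, ?_, R.orthBelow hc, ?_⟩
    · rw [rootPoly_natDegree]
      by_cases hi : OnePoint.infty ∈ R.nodes
      · have := card_eq_of_infty_mem hi; omega
      · have := card_eq_of_infty_notMem hi; omega
    -- Distinct nodes give coprime linear factors, so their product divides the node polynomial.
    · exact (Polynomial.isCoprime_X_sub_C_of_isUnit_sub (sub_ne_zero.2 hxy).isUnit).mul_dvd
        (Polynomial.dvd_iff_isRoot.2 (rootPoly_eval.2 (mem_realNodes.2 hx)))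
        (Polynomial.dvd_iff_isRoot.2 (rootPoly_eval.2 (mem_realNodes.2 hy)))

/-- For `det (x M - M') ≠ 0`, an orthogonal polynomial of degree at most `d + 1` vanishing at `x`
has degree `d + 1`. -/
lemma OrthBelow.natDegree_eq_of_eval_eq_zero {μ : Measure ℝ} {d : ℕ} {x : ℝ}
    (hx : (x • hankel μ 0 d - hankel μ 1 d).det ≠ 0) {g : ℝ[X]} (hg0 : g ≠ 0)
    (hgd : g.natDegree ≤ d + 1) (ho : OrthBelow (momentFunctional μ) d g) (hgx : g.eval x = 0) :
    g.natDegree = d + 1 := by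
  obtain ⟨p, rfl⟩ := Polynomial.dvd_iff_isRoot.2 hgx
  have hp := right_ne_zero_of_mul hg0
  have hdeg := Polynomial.natDegree_mul (Polynomial.X_sub_C_ne_zero x) hp
  rw [Polynomial.natDegree_X_sub_C] at hdeg
  -- Otherwise the cofactor p has degree < d and is a kernel vector of xM - M'.
  by_contra hne
  exact hx (det_smul_hankel_sub_eq_zero hp (by omega) ho)

/-- For `det (x M - M') ≠ 0`, there is an orthogonal polynomial of degree `d + 1` with a zero at
`x`. -/
lemma exists_orthBelow_natDegree_eq {μ : Measure ℝ} {d : ℕ} {x : ℝ}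
    (hx : (x • hankel μ 0 d - hankel μ 1 d).det ≠ 0) :
    ∃ g : ℝ[X], g ≠ 0 ∧ g.natDegree = d + 1 ∧ OrthBelow (momentFunctional μ) d g ∧
      g.eval x = 0 := by
  obtain ⟨p, hp, hpd, ho⟩ :=
    exists_orthBelow_mul (momentFunctional μ) (Polynomial.X - Polynomial.C x) d
  have h0 := mul_ne_zero (Polynomial.X_sub_C_ne_zero x) hp
  have he : ((Polynomial.X - Polynomial.C x) * p).eval x = 0 := by simp
  refine ⟨_, h0, ho.natDegree_eq_of_eval_eq_zero hx h0 ?_ he, ho, he⟩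
  rw [Polynomial.natDegree_mul (Polynomial.X_sub_C_ne_zero x) hp, Polynomial.natDegree_X_sub_C]
  omega

/-- A node at ∞ would leave an orthogonal polynomial of degree only d vanishing at x. -/
lemma QuadratureRule.infty_notMem {μ : Measure ℝ} {d : ℕ} {x : ℝ}
    (hx : (x • hankel μ 0 d - hankel μ 1 d).det ≠ 0) (R : QuadratureRule μ (2 * d))
    (hc : R.nodes.card = d + 1) (hR : (x : OnePoint ℝ) ∈ R.nodes) : OnePoint.infty ∉ R.nodes := by
  intro hi
  have h1 := card_eq_of_infty_mem hi
  have h2 := (R.orthBelow hc).natDegree_eq_of_eval_eq_zero hx (rootPoly_monic _).ne_zero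
    (by rw [rootPoly_natDegree]; omega) (rootPoly_eval.2 (mem_realNodes.2 hR))
  rw [rootPoly_natDegree] at h2
  omega

/-- The two node polynomials are monic of degree d + 1, so their difference is orthogonal of degree
≤ d and vanishes at x, hence is zero. -/
lemma QuadratureRule.eq_of_mem {μ : Measure ℝ} {d : ℕ} {x : ℝ}
    (hx : (x • hankel μ 0 d - hankel μ 1 d).det ≠ 0) (R R' : QuadratureRule μ (2 * d))
    (hc : R.nodes.card = d + 1) (hR : (x : OnePoint ℝ) ∈ R.nodes)
    (hc' : R'.nodes.card = d + 1) (hR' : (x : OnePoint ℝ) ∈ R'.nodes) : R = R' := by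
  have hi := R.infty_notMem hx hc hR
  have hi' := R'.infty_notMem hx hc' hR'
  have hn := card_eq_of_infty_notMem hi
  have hn' := card_eq_of_infty_notMem hi'
  have hpoly : rootPoly (realNodes R.nodes) = rootPoly (realNodes R'.nodes) := by
    by_contra hne
    have hdlt : (rootPoly (realNodes R.nodes) - rootPoly (realNodes R'.nodes)).natDegree < d + 1 := by
      rw [Polynomial.natDegree_lt_iff_degree_lt (sub_ne_zero.2 hne)]
      have hd1 : (rootPoly (realNodes R.nodes)).degree = ((d + 1 : ℕ) : WithBot ℕ) := by
        rw [Polynomial.degree_eq_natDegree (rootPoly_monic _).ne_zero, rootPoly_natDegree, ← hn, hc]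
      have hd2 : (rootPoly (realNodes R'.nodes)).degree = ((d + 1 : ℕ) : WithBot ℕ) := by
        rw [Polynomial.degree_eq_natDegree (rootPoly_monic _).ne_zero, rootPoly_natDegree, ← hn',
          hc']
      rw [← hd1]
      exact Polynomial.degree_sub_lt_left (hd1.trans hd2.symm) (rootPoly_monic _).ne_zero
        ((rootPoly_monic _).leadingCoeff.trans (rootPoly_monic _).leadingCoeff.symm)
    have ho : OrthBelow (momentFunctional μ) d
        (rootPoly (realNodes R.nodes) - rootPoly (realNodes R'.nodes)) := fun q hq => by
      rw [sub_mul, map_sub, R.orthBelow hc q hq, R'.orthBelow hc' q hq, sub_zero]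
    refine hdlt.ne (ho.natDegree_eq_of_eval_eq_zero hx (sub_ne_zero.2 hne) hdlt.le ?_)
    rw [Polynomial.eval_sub, rootPoly_eval.2 (mem_realNodes.2 hR),
      rootPoly_eval.2 (mem_realNodes.2 hR'), sub_zero]
  have hS : realNodes R.nodes = realNodes R'.nodes := by
    ext s; rw [← rootPoly_eval, hpoly, rootPoly_eval]
  refine QuadratureRule.ext_of_nodes ?_ hi (by omega)
  rw [eq_map_realNodes hi, eq_map_realNodes hi', hS]

/-! ### Determinant identities for the linear representation -/

open Matrix in
/-- The determinant of the bordered block diagonal matrix `diag (A, -B)`. -/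
lemma det_bordered_fromBlocks {n K : Type*} [Fintype n] [DecidableEq n] [Field K]
    {A B : Matrix n n K} (hA : A.det ≠ 0) (hB : B.det ≠ 0) (k : K) (e : n → K) :
    (Matrix.fromBlocks (Matrix.of fun _ _ : Unit => k)
      (Matrix.of fun (_ : Unit) j => Sum.elim e e j) (Matrix.of fun i (_ : Unit) => Sum.elim e e i)
      (Matrix.fromBlocks A 0 0 (-B))).det =
    (-1) ^ Fintype.card n * (A.det * B.det) * (k - e ⬝ᵥ A⁻¹ *ᵥ e + e ⬝ᵥ B⁻¹ *ᵥ e) := by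
  have hinv : Matrix.fromBlocks A 0 0 (-B) * Matrix.fromBlocks A⁻¹ 0 0 (-B⁻¹) = 1 := by
    rw [Matrix.fromBlocks_multiply]
    simp [Matrix.mul_nonsing_inv A hA.isUnit, Matrix.mul_nonsing_inv B hB.isUnit,
      Matrix.fromBlocks_one]
  let : Invertible (Matrix.fromBlocks A 0 0 (-B)) := invertibleOfRightInverse _ _ hinv
  -- Schur complement with respect to the lower right block.
  rw [Matrix.det_fromBlocks₂₂, invOf_eq_right_inv hinv, Matrix.det_fromBlocks_zero₂₁,
    Matrix.det_neg, Matrix.det_unique (n := Unit)]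
  simp only [Matrix.sub_apply, Matrix.mul_apply, Fintype.sum_sum_type, Matrix.of_apply,
    Sum.elim_inl, Sum.elim_inr, Matrix.fromBlocks_apply₁₁, Matrix.fromBlocks_apply₁₂,
    Matrix.fromBlocks_apply₂₁, Matrix.fromBlocks_apply₂₂, Matrix.zero_apply, Matrix.neg_apply,
    mul_zero, Finset.sum_const_zero, add_zero, zero_add, mul_neg, Finset.sum_neg_distrib, neg_mul]
  have h : ∀ Z : Matrix n n K, ∑ x, (∑ y, e y * Z y x) * e x = e ⬝ᵥ Z *ᵥ e := by
    intro Z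
    rw [Matrix.dotProduct_mulVec]
    rfl
  rw [h, h]
  ring

open Matrix in
/-- A rank one perturbation of `A M⁻¹ B`, where `A - B = s M`. -/
lemma det_mul_inv_mul_add_rankOne {n K : Type*} [Fintype n] [DecidableEq n] [Field K]
    {A B M : Matrix n n K} (hA : A.det ≠ 0) (hB : B.det ≠ 0) (hM : M.det ≠ 0) {s : K}
    (hs : A - B = s • M) (δ : K) (e : n → K) :
    s * (A * M⁻¹ * B + δ • Matrix.vecMulVec e e).det =
      A.det * B.det / M.det * (s + δ * (e ⬝ᵥ B⁻¹ *ᵥ e - e ⬝ᵥ A⁻¹ *ᵥ e)) := by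
  have hdet : (A * M⁻¹ * B).det = A.det * B.det / M.det := by
    rw [Matrix.det_mul, Matrix.det_mul, Matrix.det_nonsing_inv, Ring.inverse_eq_inv']
    field_simp
  have hZ : (A * M⁻¹ * B)⁻¹ = B⁻¹ * M * A⁻¹ := by
    rw [Matrix.mul_inv_rev, Matrix.mul_inv_rev, Matrix.nonsing_inv_nonsing_inv M hM.isUnit,
      Matrix.mul_assoc]
  have hd0 : (A * M⁻¹ * B).det ≠ 0 := by
    rw [hdet]; exact div_ne_zero (mul_ne_zero hA hB) hM
  have hrank : δ • Matrix.vecMulVec e e =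
      Matrix.replicateCol Unit (δ • e) * Matrix.replicateRow Unit e := by
    ext i j; simp [Matrix.vecMulVec, Matrix.mul_apply, mul_assoc]
  -- The resolvent identity.
  have hres : s • (B⁻¹ * M * A⁻¹) = B⁻¹ - A⁻¹ := by
    rw [← Matrix.smul_mul, ← Matrix.mul_smul, ← hs, Matrix.mul_sub, Matrix.sub_mul,
      Matrix.nonsing_inv_mul B hB.isUnit, Matrix.mul_assoc, Matrix.mul_nonsing_inv A hA.isUnit,
      Matrix.mul_one, Matrix.one_mul]
  have hq : s * (e ⬝ᵥ (B⁻¹ * M * A⁻¹) *ᵥ e) = e ⬝ᵥ B⁻¹ *ᵥ e - e ⬝ᵥ A⁻¹ *ᵥ e := by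
    rw [← dotProduct_sub, ← Matrix.sub_mulVec, ← hres, Matrix.smul_mulVec, dotProduct_smul,
      smul_eq_mul]
  rw [hrank, Matrix.det_add_replicateCol_mul_replicateRow hd0.isUnit, hdet, hZ,
    Matrix.det_unique (n := Unit), ← hq]
  have : (Matrix.replicateRow Unit e * (B⁻¹ * M * A⁻¹) * Matrix.replicateCol Unit (δ • e))
      default default = δ * (e ⬝ᵥ (B⁻¹ * M * A⁻¹) *ᵥ e) := by
    rw [Matrix.dotProduct_mulVec, ← smul_eq_mul (a := δ), ← dotProduct_smul]
    rfl
  rw [Matrix.add_apply, this, Matrix.one_apply_eq]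
  ring

/-- The last standard basis vector over `ℝ`. -/
def lastBasisVec (d : ℕ) (i : Fin d) : ℝ := if (i : ℕ) + 1 = d then 1 else 0

lemma hankel_transpose (μ : Measure ℝ) (k n : ℕ) : (hankel μ k n).transpose = hankel μ k n := by
  ext i j
  simp [hankel, add_comm (i : ℕ)]

/-- `M'' - M' M⁻¹ M'` is supported on the last diagonal entry, which is a quotient of successive
Hankel determinants. -/
lemma hankel_two_eq (μ : Measure ℝ) {d : ℕ} (hM : (hankel μ 0 d).det ≠ 0) :
    hankel μ 2 d = hankel μ 1 d * (hankel μ 0 d)⁻¹ * hankel μ 1 d +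
      ((hankel μ 0 (d + 1)).det / (hankel μ 0 d).det) •
        Matrix.vecMulVec (lastBasisVec d) (lastBasisVec d) := by
  set M := hankel μ 0 d with hMdef
  set M1 := hankel μ 1 d with hM1def
  -- Column j of M' is column j + 1 of M, so M⁻¹M' acts as a shift on every basis vector but the
  -- last.
  have hcol : ∀ i j : Fin d, (j : ℕ) + 1 < d →
      (M1 * M⁻¹ * M1) i j = hankel μ 2 d i j := by
    intro i j hj
    have h1 : M.mulVec (Pi.single ⟨j + 1, hj⟩ 1) = M1.mulVec (Pi.single j 1) := by
      ext i
      simp [hMdef, hM1def, hankel, add_assoc]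
    have h2 : (M1 * M⁻¹ * M1).mulVec (Pi.single j 1) = M1.mulVec (Pi.single ⟨j + 1, hj⟩ 1) := by
      rw [← Matrix.mulVec_mulVec, ← h1, Matrix.mulVec_mulVec, Matrix.mul_assoc,
        Matrix.nonsing_inv_mul M hM.isUnit, Matrix.mul_one]
    have h3 := congrFun h2 i
    simp only [Matrix.mulVec_single_one, Matrix.col_apply] at h3
    rw [h3]
    simp only [hM1def, hankel, Matrix.of_apply]
    congr! 3
  have hsymm : (M1 * M⁻¹ * M1).transpose = M1 * M⁻¹ * M1 := by
    rw [Matrix.transpose_mul, Matrix.transpose_mul, Matrix.transpose_nonsing_inv,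
      hankel_transpose, hankel_transpose, Matrix.mul_assoc]
  ext i j
  simp only [Matrix.add_apply, Matrix.smul_apply, Matrix.vecMulVec_apply, lastBasisVec, smul_eq_mul]
  by_cases hj : (j : ℕ) + 1 = d
  swap
  · rw [hcol i j (by omega), if_neg hj]; simp
  by_cases hi : (i : ℕ) + 1 = d
  swap
  · rw [← hsymm, Matrix.transpose_apply, hcol j i (by omega), if_neg hi,
      ← hankel_transpose μ 2 d, Matrix.transpose_apply, hankel_transpose]
    simp
  obtain rfl : i = j := Fin.ext (by omega)
  rw [if_pos hi]
  let : Invertible M := Matrix.invertibleOfIsUnitDet M hM.isUnit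
  -- M_d is M_{d-1} bordered by the last column of M', so the corner entry of M'' - M'M⁻¹M' is a
  -- Schur complement.
  have hblock : (hankel μ 0 (d + 1)).submatrix finSumFinEquiv finSumFinEquiv =
      Matrix.fromBlocks M (Matrix.of fun a (_ : Fin 1) => M1 a i)
        (Matrix.of fun (_ : Fin 1) b => M1 i b) (Matrix.of fun _ _ => hankel μ 2 d i i) := by
    ext a b
    rcases a with a | a <;> rcases b with b | b <;>
      simp only [hMdef, hM1def, hankel, Matrix.submatrix_apply, Matrix.of_apply,
        finSumFinEquiv_apply_left, finSumFinEquiv_apply_right, Matrix.fromBlocks_apply₁₁,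
        Matrix.fromBlocks_apply₁₂, Matrix.fromBlocks_apply₂₁, Matrix.fromBlocks_apply₂₂,
        Fin.val_castAdd, Fin.val_natAdd, Fin.val_eq_zero] <;>
      congr! 3 <;> omega
  have hdet : (hankel μ 0 (d + 1)).det =
      M.det * (hankel μ 2 d i i - (M1 * M⁻¹ * M1) i i) := by
    rw [← Matrix.det_submatrix_equiv_self finSumFinEquiv, hblock, Matrix.det_fromBlocks₁₁,
      Matrix.det_unique (n := Fin 1), Matrix.invOf_eq_nonsing_inv]
    simp [Matrix.mul_apply]
  rw [hdet]
  field_simp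
  ring

/-- The determinantal identity between the bilinear and the linear matrix at a generic point. -/
lemma sub_mul_det_bilinear {μ : Measure ℝ} {d : ℕ} (hM : (hankel μ 0 d).det ≠ 0)
    (hM1 : (hankel μ 0 (d + 1)).det ≠ 0) {x y : ℝ}
    (hx : (x • hankel μ 0 d - hankel μ 1 d).det ≠ 0)
    (hy : (y • hankel μ 0 d - hankel μ 1 d).det ≠ 0) :
    (x - y) * ((x * y) • hankel μ 0 d - (x + y) • hankel μ 1 d + hankel μ 2 d).det =
      (-1) ^ d * (hankel μ 0 (d + 1)).det / (hankel μ 0 d).det ^ 2 *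
      (Matrix.fromBlocks
        (Matrix.of fun _ _ : Unit => (hankel μ 0 d).det / (hankel μ 0 (d + 1)).det * (x - y))
        (Matrix.of fun (_ : Unit) j => Sum.elim (lastBasisVec d) (lastBasisVec d) j)
        (Matrix.of fun i (_ : Unit) => Sum.elim (lastBasisVec d) (lastBasisVec d) i)
        (Matrix.fromBlocks (x • hankel μ 0 d - hankel μ 1 d) 0 0
          (-(y • hankel μ 0 d - hankel μ 1 d)))).det := by
  have hfac : (x * y) • hankel μ 0 d - (x + y) • hankel μ 1 d + hankel μ 2 d =
      (x • hankel μ 0 d - hankel μ 1 d) * (hankel μ 0 d)⁻¹ * (y • hankel μ 0 d - hankel μ 1 d) +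
      ((hankel μ 0 (d + 1)).det / (hankel μ 0 d).det) •
        Matrix.vecMulVec (lastBasisVec d) (lastBasisVec d) := by
    rw [hankel_two_eq μ hM, ← add_assoc]
    congr 1
    rw [Matrix.sub_mul, Matrix.smul_mul, Matrix.mul_nonsing_inv _ hM.isUnit, Matrix.mul_sub,
      Matrix.sub_mul, Matrix.sub_mul, Matrix.mul_smul, Matrix.mul_smul,
      Matrix.mul_assoc (hankel μ 1 d) _ (hankel μ 0 d), Matrix.nonsing_inv_mul _ hM.isUnit,
      Matrix.smul_mul, Matrix.smul_mul, Matrix.one_mul, Matrix.one_mul, Matrix.mul_one, smul_smul,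
      add_smul, mul_comm x y]
    abel
  rw [hfac, det_mul_inv_mul_add_rankOne hx hy hM (s := x - y) (by rw [sub_smul]; abel),
    det_bordered_fromBlocks hx hy, Fintype.card_fin]
  -- The sign in c cancels the sign coming from the block -B.
  have hsq : ((-1 : ℝ) ^ d) * (-1) ^ d = 1 := by
    rw [← mul_pow]; norm_num
  field_simp
  linear_combination (-(hankel μ 0 d).det * (x - y) - (hankel μ 0 (d + 1)).det *
    (dotProduct (lastBasisVec d) ((y • hankel μ 0 d - hankel μ 1 d)⁻¹.mulVec (lastBasisVec d)) -
     dotProduct (lastBasisVec d) ((x • hankel μ 0 d - hankel μ 1 d)⁻¹.mulVec (lastBasisVec d)))) * hsq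

/-! ### Divisibility of bivariate polynomials through their fibres -/

/-- The coefficient of degree d need not be a unit, so each reduction step multiplies g by it before
cancelling the top term. -/
lemma exists_pseudo_div {R : Type*} [CommRing R] {f : R[X]} {d : ℕ} (hf : f.natDegree ≤ d)
    (g : R[X]) : ∃ (k : ℕ) (q r : R[X]),
      Polynomial.C (f.coeff d) ^ k * g = f * q + r ∧ r.degree < d := by
  suffices H : ∀ (n : ℕ) (g : R[X]), g.degree < n → ∃ (k : ℕ) (q r : R[X]),
      Polynomial.C (f.coeff d) ^ k * g = f * q + r ∧ r.degree < d from
    H _ g (Polynomial.degree_lt_iff_coeff_zero _ _ |>.2 fun m hm =>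
      Polynomial.coeff_eq_zero_of_natDegree_lt (Nat.lt_of_succ_le hm))
  intro n
  induction n with
  | zero =>
    intro g hg
    exact ⟨0, 0, g, by simp, hg.trans_le (by exact_mod_cast Nat.zero_le d)⟩
  | succ n ih =>
    intro g hg
    rcases lt_or_ge n d with hnd | hnd
    · exact ⟨0, 0, g, by simp, hg.trans_le (by exact_mod_cast hnd)⟩
    rw [Polynomial.degree_lt_iff_coeff_zero] at hg
    obtain ⟨k, q, r, h, hr⟩ := ih (Polynomial.C (f.coeff d) * g -
      Polynomial.C (g.coeff n) * (Polynomial.X ^ (n - d) * f)) <| by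
        rw [Polynomial.degree_lt_iff_coeff_zero]
        intro m hm
        rw [Polynomial.coeff_sub, Polynomial.coeff_C_mul, Polynomial.coeff_C_mul,
          Polynomial.coeff_X_pow_mul', if_pos (by omega)]
        rcases hm.eq_or_lt with rfl | hlt
        · rw [Nat.sub_sub_self hnd]; ring
        · rw [hg m hlt, Polynomial.coeff_eq_zero_of_natDegree_lt
            (show f.natDegree < m - (n - d) by omega)]
          ring
    refine ⟨k + 1, q + Polynomial.C (f.coeff d) ^ k * Polynomial.C (g.coeff n) *
      Polynomial.X ^ (n - d), r, ?_, hr⟩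
    linear_combination h

lemma not_C_X_sub_C_dvd {f : ℝ[X][X]} {r : ℝ} (h : f.map (Polynomial.evalRingHom r) ≠ 0) :
    ¬ Polynomial.C (Polynomial.X - Polynomial.C r) ∣ f := by
  rintro ⟨q, rfl⟩
  simp at h

/-- Cancelling a factor in the inner variable none of whose zeros annihilates `f`. -/
lemma dvd_of_dvd_C_mul {f g : ℝ[X][X]} {a : ℝ[X]} (ha0 : a ≠ 0) (ha : a.Splits)
    (hf : ∀ r, a.eval r = 0 → f.map (Polynomial.evalRingHom r) ≠ 0)
    (h : f ∣ Polynomial.C a * g) : f ∣ g := by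
  have key : ∀ (s : Multiset ℝ), (∀ r ∈ s, f.map (Polynomial.evalRingHom r) ≠ 0) →
      ∀ g, f ∣ Polynomial.C (s.map fun r => Polynomial.X - Polynomial.C r).prod * g → f ∣ g := by
    intro s
    induction s using Multiset.induction_on with
    | empty => intro _ g hg; simpa using hg
    | cons r s ih =>
      intro hs g hg
      refine ih (fun t ht => hs t (Multiset.mem_cons_of_mem ht)) g ?_
      rw [Multiset.map_cons, Multiset.prod_cons, Polynomial.C_mul, mul_assoc] at hg
      have hp : Prime (Polynomial.C (Polynomial.X - Polynomial.C r) : ℝ[X][X]) :=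
        Polynomial.prime_C_iff.2 (Polynomial.prime_X_sub_C r)
      obtain ⟨q, hq⟩ := hg
      -- The prime x - r does not divide f, so it divides the cofactor q.
      obtain ⟨q', rfl⟩ := (hp.dvd_or_dvd (Dvd.intro _ hq)).resolve_left
        (not_C_X_sub_C_dvd (hs r (Multiset.mem_cons_self r s)))
      exact ⟨q', mul_left_cancel₀ hp.ne_zero (by rw [hq]; ring)⟩
  refine key a.roots (fun r hr => hf r ((Polynomial.mem_roots ha0).1 hr)) g ?_
  have h1 : a = Polynomial.C a.leadingCoeff *
      (a.roots.map fun r => Polynomial.X - Polynomial.C r).prod := ha.eq_prod_roots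
  have hu : IsUnit (Polynomial.C (Polynomial.C a.leadingCoeff) : ℝ[X][X]) :=
    Polynomial.isUnit_C.2 (Polynomial.isUnit_C.2 (by simpa using ha0))
  rw [h1, Polynomial.C_mul, mul_assoc] at h
  exact hu.dvd_mul_left.1 h

/-- A polynomial in two variables whose generic fibres have only simple real zeros divides every
polynomial vanishing at these zeros. -/
lemma dvd_of_fibre_zeros {f g : ℝ[X][X]} {d : ℕ} (hfd : f.natDegree ≤ d)
    (ha0 : f.coeff d ≠ 0) (ha : (f.coeff d).Splits)
    (hf : ∀ r, (f.coeff d).eval r = 0 → f.map (Polynomial.evalRingHom r) ≠ 0)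
    (hz : ∀ r, (f.coeff d).eval r ≠ 0 → ∃ S : Finset ℝ, S.card = d ∧ ∀ y ∈ S,
      (f.map (Polynomial.evalRingHom r)).eval y = 0 ∧
      (g.map (Polynomial.evalRingHom r)).eval y = 0) : f ∣ g := by
  obtain ⟨k, q, r, h, hr⟩ := exists_pseudo_div hfd g
  have hfib : ∀ x, (f.coeff d).eval x ≠ 0 → r.map (Polynomial.evalRingHom x) = 0 := by
    intro x hx
    obtain ⟨S, hS, hSz⟩ := hz x hx
    -- Over a generic x the remainder has degree < d but d zeros.
    refine Polynomial.eq_zero_of_degree_lt_of_eval_finset_eq_zero S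
      (Polynomial.degree_map_le.trans_lt (hS ▸ hr)) fun y hy => ?_
    have h1 := congrArg (fun p => (p.map (Polynomial.evalRingHom x)).eval y) h
    simp only [Polynomial.map_mul, Polynomial.map_add, Polynomial.eval_mul,
      Polynomial.eval_add, (hSz y hy).1, (hSz y hy).2] at h1
    simpa using h1.symm
  have hr0 : r = 0 := by
    ext1 n
    rw [Polynomial.coeff_zero]
    by_contra hne
    -- A nonzero coefficient of r survives at some x where the leading coefficient of f does too.
    obtain ⟨x, hx⟩ : ∃ x, (f.coeff d * r.coeff n).eval x ≠ 0 := by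
      by_contra! h0
      exact mul_ne_zero ha0 hne (Polynomial.funext fun x => by rw [h0 x, Polynomial.eval_zero])
    rw [Polynomial.eval_mul] at hx
    have := congrArg (fun p => p.coeff n) (hfib x (left_ne_zero_of_mul hx))
    simp only [Polynomial.coeff_map, Polynomial.coeff_zero, Polynomial.coe_evalRingHom] at this
    exact right_ne_zero_of_mul hx this
  rw [hr0, add_zero] at h
  replace h : f ∣ Polynomial.C (f.coeff d) ^ k * g := ⟨q, h⟩
  clear hr hfib hr0 hz
  induction k with
  | zero => simpa using h
  | succ k ih =>
    rw [pow_succ', mul_assoc] at h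
    exact ih (dvd_of_dvd_C_mul ha0 ha hf h)

/-- Polynomials in `x = X 0`, `y = X 1` as polynomials in `y` over `ℝ[x]`. -/
noncomputable def toBivariate : MvPolynomial (Fin 2) ℝ →+* ℝ[X][X] :=
  eval₂Hom (Polynomial.C.comp Polynomial.C) ![Polynomial.C Polynomial.X, Polynomial.X]

/-- The inverse of `toBivariate`. -/
noncomputable def ofBivariate : ℝ[X][X] →+* MvPolynomial (Fin 2) ℝ :=
  Polynomial.eval₂RingHom (Polynomial.eval₂RingHom C (X 0)) (X 1)

lemma ofBivariate_toBivariate (G : MvPolynomial (Fin 2) ℝ) :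
    ofBivariate (toBivariate G) = G := by
  have : ofBivariate.comp toBivariate = RingHom.id _ := by
    apply MvPolynomial.ringHom_ext
    · intro r; simp [ofBivariate, toBivariate]
    · intro i; fin_cases i <;> simp [ofBivariate, toBivariate]
  exact congrArg (fun φ => φ G) this

lemma eval_map_toBivariate (x y : ℝ) (G : MvPolynomial (Fin 2) ℝ) :
    ((toBivariate G).map (Polynomial.evalRingHom x)).eval y = eval ![x, y] G := by
  have : ((Polynomial.evalRingHom y).comp
      (Polynomial.mapRingHom (Polynomial.evalRingHom x))).comp toBivariate = eval ![x, y] := by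
    apply MvPolynomial.ringHom_ext
    · intro r; simp [toBivariate]
    · intro i; fin_cases i <;> simp [toBivariate]
  exact congrArg (fun φ => φ G) this

/-! ### The pencil determinant and its real zeros -/

/-- The polynomial `det (x M - M')`. -/
noncomputable def pencilDet (μ : Measure ℝ) (d : ℕ) : ℝ[X] :=
  ((Polynomial.X : ℝ[X]) • (hankel μ 0 d).map Polynomial.C +
    (-hankel μ 1 d).map Polynomial.C).det

lemma eval_pencilDet (μ : Measure ℝ) (d : ℕ) (x : ℝ) :
    (pencilDet μ d).eval x = (x • hankel μ 0 d - hankel μ 1 d).det := by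
  rw [pencilDet, ← Polynomial.coe_evalRingHom, RingHom.map_det]
  congr 1
  ext i j
  simp [sub_eq_add_neg, mul_comm x]

lemma natDegree_pencilDet_le (μ : Measure ℝ) (d : ℕ) : (pencilDet μ d).natDegree ≤ d :=
  (Polynomial.natDegree_det_X_add_C_le _ _).trans_eq (Fintype.card_fin d)

lemma coeff_pencilDet (μ : Measure ℝ) (d : ℕ) :
    (pencilDet μ d).coeff d = (hankel μ 0 d).det := by
  have := Polynomial.coeff_det_X_add_C_card (hankel μ 0 d) (-hankel μ 1 d)
  rwa [Fintype.card_fin] at this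

lemma NonDegenerate.pencilDet_ne_zero {μ : Measure ℝ} {d : ℕ} (h : NonDegenerate μ d) :
    pencilDet μ d ≠ 0 := fun h0 => by
  have := coeff_pencilDet μ d
  rw [h0, Polynomial.coeff_zero] at this
  exact h.det_hankel_ne_zero (Nat.le_succ d) this.symm

/-- All zeros of `det (x M - M')` are real. -/
lemma NonDegenerate.splits_pencilDet {μ : Measure ℝ} {d : ℕ} (h : NonDegenerate μ d) :
    (pencilDet μ d).Splits := by
  have hΛ := h.positiveUpTo
  -- Weight 1 gives an orthogonal p of degree exactly d; each of its d distinct zeros is a zero of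
  -- the pencil determinant.
  obtain ⟨p, hp, hpd, ho⟩ := exists_orthBelow_mul (momentFunctional μ) 1 d
  rw [one_mul] at ho
  obtain ⟨S, hcard, hS, -⟩ := ho.exists_rootPoly hΛ hp (by omega)
  have hle := ho.le_natDegree hΛ hp
  rw [Polynomial.splits_iff_card_roots]
  refine le_antisymm (Polynomial.card_roots' _) ((natDegree_pencilDet_le μ d).trans ?_)
  refine (show d ≤ S.card by omega).trans (Multiset.card_le_card (s := S.val) ?_)
  rw [Multiset.le_iff_subset S.nodup]
  intro s hs
  rw [Polynomial.mem_roots h.pencilDet_ne_zero, Polynomial.IsRoot, eval_pencilDet]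
  obtain ⟨q, rfl⟩ := Polynomial.dvd_iff_isRoot.2 ((hS s).1 hs)
  have hq := right_ne_zero_of_mul hp
  rw [Polynomial.natDegree_mul (Polynomial.X_sub_C_ne_zero s) hq, Polynomial.natDegree_X_sub_C]
    at hpd
  exact det_smul_hankel_sub_eq_zero hq (by omega) ho

/-! ### Degree and uniqueness of the node polynomial -/

lemma eval_det_bilinearMatrix (μ : Measure ℝ) (d : ℕ) (x y : ℝ) :
    eval ![x, y] (bilinearMatrix μ d).det =
      ((x * y) • hankel μ 0 d - (x + y) • hankel μ 1 d + hankel μ 2 d).det := by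
  rw [RingHom.map_det]
  congr 1
  ext i j
  simp [bilinearMatrix, constMatrix]

/-- Grouping by powers of y gives the pencil y(xM - M') + (M'' - xM'), from which the coefficient of
y^d can be read off. -/
lemma toBivariate_det_bilinearMatrix (μ : Measure ℝ) (d : ℕ) :
    toBivariate (bilinearMatrix μ d).det =
      ((Polynomial.X : ℝ[X][X]) • ((Polynomial.X : ℝ[X]) • (hankel μ 0 d).map Polynomial.C +
        (-hankel μ 1 d).map Polynomial.C).map Polynomial.C +
        ((Polynomial.X : ℝ[X]) • (-hankel μ 1 d).map Polynomial.C +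
          (hankel μ 2 d).map Polynomial.C).map Polynomial.C).det := by
  rw [RingHom.map_det]
  congr 1
  ext1 i j
  simp [bilinearMatrix, constMatrix, toBivariate]
  ring

/-- The same pencil with the roles of x and y exchanged, since `finSuccEquiv` splits off `X 0`. -/
lemma finSuccEquiv_det_bilinearMatrix (μ : Measure ℝ) (d : ℕ) :
    finSuccEquiv ℝ 1 (bilinearMatrix μ d).det =
      ((Polynomial.X : (MvPolynomial (Fin 1) ℝ)[X]) •
        ((X 0 : MvPolynomial (Fin 1) ℝ) • (hankel μ 0 d).map C +
        (-hankel μ 1 d).map C).map Polynomial.C +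
        ((X 0 : MvPolynomial (Fin 1) ℝ) • (-hankel μ 1 d).map C +
          (hankel μ 2 d).map C).map Polynomial.C).det := by
  have hC : ∀ r : ℝ, finSuccEquiv ℝ 1 (C r) = Polynomial.C (C r) := fun r =>
    (finSuccEquiv ℝ 1).commutes r
  have h1 : finSuccEquiv ℝ 1 (X 1) = Polynomial.C (X 0) := finSuccEquiv_X_succ (j := 0)
  rw [AlgEquiv.map_det]
  congr 1
  ext1 i j
  simp [bilinearMatrix, constMatrix, hC, h1, finSuccEquiv_X_zero]
  ring

lemma totalDegree_det_le {σ R n : Type*} [CommRing R] [Fintype n] [DecidableEq n]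
    {A : Matrix n n (MvPolynomial σ R)} {k : ℕ} (hA : ∀ i j, (A i j).totalDegree ≤ k) :
    A.det.totalDegree ≤ Fintype.card n * k := by
  rw [Matrix.det_apply]
  refine totalDegree_finsetSum_le fun τ _ => ?_
  have : (∏ i, A (τ i) i).totalDegree ≤ Fintype.card n * k := by
    refine (totalDegree_finsetProd _ _).trans ((Finset.sum_le_card_nsmul _ _ k fun i _ =>
      hA _ _).trans_eq ?_)
    simp
  rcases Int.units_eq_one_or (Equiv.Perm.sign τ) with h | h <;> rw [h]
  · simpa using this
  · simpa using this

lemma totalDegree_det_bilinearMatrix_le (μ : Measure ℝ) (d : ℕ) :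
    (bilinearMatrix μ d).det.totalDegree ≤ 2 * d := by
  refine (totalDegree_det_le (k := 2) fun i j => ?_).trans_eq (by simp [mul_comm])
  have h0 : (X 0 : MvPolynomial (Fin 2) ℝ).totalDegree = 1 := totalDegree_X 0
  have h1 : (X 1 : MvPolynomial (Fin 2) ℝ).totalDegree = 1 := totalDegree_X 1
  have hm := totalDegree_mul (X 0 : MvPolynomial (Fin 2) ℝ) (X 1)
  have ha := totalDegree_add (X 0 : MvPolynomial (Fin 2) ℝ) (X 1)
  simp only [bilinearMatrix, constMatrix, Matrix.add_apply, Matrix.sub_apply, Matrix.smul_apply,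
    Matrix.map_apply, smul_eq_mul]
  refine (totalDegree_add _ _).trans (max_le ((totalDegree_sub _ _).trans (max_le ?_ ?_)) ?_)
  · refine (totalDegree_mul _ _).trans ?_
    rw [totalDegree_C]; omega
  · refine (totalDegree_mul _ _).trans ?_
    rw [totalDegree_C, h0, h1, max_self] at *
    omega
  · rw [totalDegree_C]; omega

/-- The coefficient of x^d is det(yM - M'), whose own top coefficient is det M ≠ 0; so the monomial
x^d y^d occurs. -/
lemma NonDegenerate.totalDegree_det_bilinearMatrix {μ : Measure ℝ} {d : ℕ}
    (h : NonDegenerate μ d) : (bilinearMatrix μ d).det.totalDegree = 2 * d := by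
  refine le_antisymm (totalDegree_det_bilinearMatrix_le μ d) ?_
  set c := (finSuccEquiv ℝ 1 (bilinearMatrix μ d).det).coeff d with hc
  have hcdet : c = ((X 0 : MvPolynomial (Fin 1) ℝ) • (hankel μ 0 d).map C +
        (-hankel μ 1 d).map C).det := by
    have := Polynomial.coeff_det_X_add_C_card (n := Fin d) (α := MvPolynomial (Fin 1) ℝ)
      ((X 0 : MvPolynomial (Fin 1) ℝ) • (hankel μ 0 d).map (C : ℝ → MvPolynomial (Fin 1) ℝ) +
        (-hankel μ 1 d).map (C : ℝ → MvPolynomial (Fin 1) ℝ))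
      ((X 0 : MvPolynomial (Fin 1) ℝ) • (-hankel μ 1 d).map (C : ℝ → MvPolynomial (Fin 1) ℝ) +
        (hankel μ 2 d).map (C : ℝ → MvPolynomial (Fin 1) ℝ))
    rwa [Fintype.card_fin, ← finSuccEquiv_det_bilinearMatrix] at this
  have hac : aeval (fun _ => (Polynomial.X : ℝ[X])) c = pencilDet μ d := by
    rw [hcdet, AlgHom.map_det, pencilDet]
    congr 1
    ext1 i j
    simp
  have hdeg := aeval_natDegree_le c le_rfl (fun _ => (Polynomial.X : ℝ[X])) (n := 1) (by simp)
  rw [hac, mul_one] at hdeg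
  have hd : d ≤ (pencilDet μ d).natDegree := Polynomial.le_natDegree_of_ne_zero <| by
    rw [coeff_pencilDet]; exact h.det_hankel_ne_zero (Nat.le_succ d)
  have hc0 : c ≠ 0 := fun h0 => h.pencilDet_ne_zero (by rw [← hac, h0, map_zero])
  have := totalDegree_coeff_finSuccEquiv_add_le _ d hc0
  rw [← hc] at this
  omega

lemma NonDegenerate.isNodePolynomial_det {μ : Measure ℝ} {d : ℕ} (h : NonDegenerate μ d) :
    IsNodePolynomial μ d (bilinearMatrix μ d).det :=
  ⟨h.totalDegree_det_bilinearMatrix, fun x y => by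
    rw [eval_det_bilinearMatrix, h.det_bilinear_eq_zero_iff_exists_rule]⟩

/-- The two-node determinant divides every polynomial vanishing on its real zero set. -/
lemma NonDegenerate.det_bilinearMatrix_dvd {μ : Measure ℝ} {d : ℕ} (h : NonDegenerate μ d)
    {G : MvPolynomial (Fin 2) ℝ}
    (hG : ∀ x y : ℝ, eval ![x, y] (bilinearMatrix μ d).det = 0 → eval ![x, y] G = 0) :
    (bilinearMatrix μ d).det ∣ G := by
  have hcoeff : (toBivariate (bilinearMatrix μ d).det).coeff d = pencilDet μ d := by
    rw [toBivariate_det_bilinearMatrix, pencilDet]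
    have := Polynomial.coeff_det_X_add_C_card (n := Fin d) (α := ℝ[X])
      ((Polynomial.X : ℝ[X]) • (hankel μ 0 d).map Polynomial.C +
        (-hankel μ 1 d).map Polynomial.C)
      ((Polynomial.X : ℝ[X]) • (-hankel μ 1 d).map Polynomial.C +
        (hankel μ 2 d).map Polynomial.C)
    rwa [Fintype.card_fin] at this
  have hdvd : toBivariate (bilinearMatrix μ d).det ∣ toBivariate G := by
    refine dvd_of_fibre_zeros (d := d) ?_ ?_ ?_ ?_ ?_
    · rw [toBivariate_det_bilinearMatrix]
      exact (Polynomial.natDegree_det_X_add_C_le _ _).trans_eq (Fintype.card_fin d)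
    · rw [hcoeff]; exact h.pencilDet_ne_zero
    · rw [hcoeff]; exact h.splits_pencilDet
    · intro r _ h0
      have := eval_map_toBivariate r r (bilinearMatrix μ d).det
      rw [h0, Polynomial.eval_zero, eval_det_bilinearMatrix] at this
      exact h.det_bilinear_self_ne_zero r this.symm
    · intro r hr
      rw [hcoeff, eval_pencilDet] at hr
      obtain ⟨g, hg0, hgd, ho, hgr⟩ := exists_orthBelow_natDegree_eq hr
      obtain ⟨S, hcard, hS, -⟩ := ho.exists_rootPoly h.positiveUpTo hg0 hgd.le
      -- The d zeros on the fibre are the other nodes of the rule through r.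
      refine ⟨S.erase r, ?_, fun y hy => ?_⟩
      · rw [Finset.card_erase_of_mem ((hS r).2 hgr)]; omega
      · have hry : r ≠ y := (Finset.ne_of_mem_erase hy).symm
        have h0 : eval ![r, y] (bilinearMatrix μ d).det = 0 := by
          rw [eval_det_bilinearMatrix, det_bilinear_eq_zero_iff]
          refine ⟨g, hg0, hgd.le, ho, ?_⟩
          exact (Polynomial.isCoprime_X_sub_C_of_isUnit_sub (sub_ne_zero.2 hry).isUnit).mul_dvd
            (Polynomial.dvd_iff_isRoot.2 hgr)
            (Polynomial.dvd_iff_isRoot.2 ((hS y).1 (Finset.mem_of_mem_erase hy)))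
        rw [eval_map_toBivariate, eval_map_toBivariate]
        exact ⟨h0, hG r y h0⟩
  have := map_dvd ofBivariate hdvd
  rwa [ofBivariate_toBivariate, ofBivariate_toBivariate] at this

lemma NonDegenerate.eq_C_mul_of_isNodePolynomial {μ : Measure ℝ} {d : ℕ} (hd : 1 ≤ d)
    (h : NonDegenerate μ d) {G : MvPolynomial (Fin 2) ℝ} (hG : IsNodePolynomial μ d G) :
    ∃ a : ℝ, a ≠ 0 ∧ G = C a * (bilinearMatrix μ d).det := by
  have hF := h.isNodePolynomial_det
  obtain ⟨Q, rfl⟩ := h.det_bilinearMatrix_dvd fun x y h0 => (hG.2 x y).2 ((hF.2 x y).1 h0)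
  -- The zero polynomial has total degree 0, which differs from 2d because d ≥ 1.
  have h0 : (bilinearMatrix μ d).det * Q ≠ 0 := by
    intro h0
    have := hG.1
    rw [h0, totalDegree_zero] at this
    omega
  have hdeg := hG.1
  rw [totalDegree_mul_of_isDomain (left_ne_zero_of_mul h0) (right_ne_zero_of_mul h0), hF.1] at hdeg
  have hQ := totalDegree_eq_zero_iff_eq_C.1 (show Q.totalDegree = 0 by omega)
  refine ⟨Q.coeff 0, fun ha => right_ne_zero_of_mul h0 ?_, ?_⟩
  · rw [hQ, ha, C_0]
  · rw [← hQ, mul_comm]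

/-! ### The linear determinantal representation and the theorem -/

lemma eval_det_linearMatrix (μ : Measure ℝ) (d : ℕ) (x y : ℝ) :
    eval ![x, y] (linearMatrix μ d).det = (Matrix.fromBlocks
        (Matrix.of fun _ _ : Unit => (hankel μ 0 d).det / (hankel μ 0 (d + 1)).det * (x - y))
        (Matrix.of fun (_ : Unit) j => Sum.elim (lastBasisVec d) (lastBasisVec d) j)
        (Matrix.of fun i (_ : Unit) => Sum.elim (lastBasisVec d) (lastBasisVec d) i)
        (Matrix.fromBlocks (x • hankel μ 0 d - hankel μ 1 d) 0 0
          (-(y • hankel μ 0 d - hankel μ 1 d)))).det := by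
  rw [RingHom.map_det]
  congr 1
  ext1 i j
  rcases i with i | i | i <;> rcases j with j | j | j <;>
    simp [linearMatrix, constMatrix, lastVec, lastBasisVec, apply_ite]
  ring

/-- The determinantal representation by the linear matrix. -/
lemma NonDegenerate.sub_mul_det_bilinearMatrix {μ : Measure ℝ} {d : ℕ} (h : NonDegenerate μ d) :
    (X 0 - X 1) * (bilinearMatrix μ d).det =
      C ((-1) ^ d * (hankel μ 0 (d + 1)).det / (hankel μ 0 d).det ^ 2) *
        (linearMatrix μ d).det := by
  -- Multiplying both sides by det(xM - M') det(yM - M') makes the identity trivial wherever a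
  -- pencil is singular; the nonzero factor is cancelled.
  let a : Fin 2 → MvPolynomial (Fin 2) ℝ := fun i => Polynomial.aeval (X i) (pencilDet μ d)
  have ha : ∀ (v : Fin 2 → ℝ) i, eval v (a i) = (pencilDet μ d).eval (v i) := by
    intro v i
    have : eval v (a i) = aeval v (a i) := (congrArg (fun φ => φ (a i)) (coe_aeval_eq_eval v)).symm
    rw [this, ← Polynomial.aeval_algHom_apply, aeval_X, Polynomial.coe_aeval_eq_eval]
  obtain ⟨r, hr⟩ : ∃ r, (pencilDet μ d).eval r ≠ 0 := by
    by_contra! h0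
    exact h.pencilDet_ne_zero (Polynomial.funext fun x => by rw [h0 x, Polynomial.eval_zero])
  have ha0 : a 0 * a 1 ≠ 0 := fun h0 => by
    have := congrArg (eval fun _ => r) h0
    rw [map_mul, ha, ha, map_zero] at this
    exact mul_ne_zero hr hr this
  refine mul_left_cancel₀ ha0 (MvPolynomial.funext fun v => ?_)
  obtain ⟨x, y, rfl⟩ : ∃ x y, v = ![x, y] :=
    ⟨v 0, v 1, by ext i; fin_cases i <;> rfl⟩
  simp only [map_mul, ha, map_sub, eval_X, eval_C, eval_det_bilinearMatrix, eval_det_linearMatrix,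
    Matrix.cons_val_zero, Matrix.cons_val_one, eval_pencilDet]
  by_cases hx : (x • hankel μ 0 d - hankel μ 1 d).det = 0
  · rw [hx]; ring
  by_cases hy : (y • hankel μ 0 d - hankel μ 1 d).det = 0
  · rw [hy]; ring
  rw [sub_mul_det_bilinear (h.det_hankel_ne_zero (Nat.le_succ d)) (h.det_hankel_ne_zero le_rfl)
    hx hy]

theorem theorem1p3 (μ : Measure ℝ) (d : ℕ) (hd : 1 ≤ d) (hμ : NonDegenerate μ d) :
    (∃ F : MvPolynomial (Fin 2) ℝ,
      IsNodePolynomial μ d F ∧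
      (∀ G : MvPolynomial (Fin 2) ℝ, IsNodePolynomial μ d G → ∃ a : ℝ, a ≠ 0 ∧ G = C a * F) ∧
      F = (bilinearMatrix μ d).det ∧
      (X 0 - X 1) * F =
        C ((-1) ^ d * (hankel μ 0 (d + 1)).det / (hankel μ 0 d).det ^ 2) *
          (linearMatrix μ d).det) ∧
    ∀ x : ℝ, (x • hankel μ 0 d - hankel μ 1 d).det ≠ 0 →
      (∃! R : QuadratureRule μ (2 * d),
        R.IsGaussian ∧ R.nodes.card = d + 1 ∧ (x : OnePoint ℝ) ∈ R.nodes) ∧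
      ∀ R : QuadratureRule μ (2 * d),
        R.IsGaussian → R.nodes.card = d + 1 → (x : OnePoint ℝ) ∈ R.nodes →
          OnePoint.infty ∉ R.nodes := by
  refine ⟨⟨_, hμ.isNodePolynomial_det, fun G hG => hμ.eq_C_mul_of_isNodePolynomial hd hG, rfl,
    hμ.sub_mul_det_bilinearMatrix⟩, fun x hx => ⟨?_, fun R _ hc hR => R.infty_notMem hx hc hR⟩⟩
  obtain ⟨g, hg0, hgd, ho, hgx⟩ := exists_orthBelow_natDegree_eq hx
  obtain ⟨R, hR, hc, hn⟩ := QuadratureRule.exists_of_orthBelow hμ hg0 hgd.le ho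
  exact ⟨R, ⟨hR, hc, (hn x).2 hgx⟩, fun R' ⟨_, hc', hR'⟩ =>
    QuadratureRule.eq_of_mem hx R' R hc' hR' hc ((hn x).2 hgx)⟩
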